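/- Let $n,p$ be natural numbers, let $x$ and $v$ be zero-mean random vectors in $\mathbb{R}^p$ and $\mathbb{R}^n$ with finite second moments that are uncorrelated with each other ($K_{xv}=0$), and, for $A\in\mathbb{R}^{n\times p}$, let $y=Ax+v$. Write $K_z$ for the covariance matrix of a random vector $z$. Let $S\subseteq\{1,\dots,p\}$ have $p_S$ elements and let its complement $C$ have $p_C=p-p_S$ elements; let $x_S$, $x_C$ be the corresponding subvectors of $x$, and $A_S$ the submatrix of the columns of $A$ indexed by $S$. Consider the linear minimum MSE estimator of $x_S$ that is based on the partial model $y=A_Sx_S+z$ with assumed covariances $\hat K_{x_S}$ and $\hat K_z$, namely $\hat x_S=W_Sy$ with $$W_S=\hat K_{x_S}A_S^{\mathrm T}\bigl(A_S\hat K_{x_S}A_S^{\mathrm T}+\hat K_z\bigr)^+,$$ where $^+$ is the Moore-Penrose pseudoinverse, in the case $\hat K_{x_S}=I_{p_S}$, $\hat K_z=0$. Its MSE for given $A$ is $J_S(W_S)=\mathbb{E}_{x,v}\bigl[\|x_S-W_Sy\|^2\bigr]$, where $y=Ax+v$ comes from the full model. Let now $A$ be random with i.i.d. rows distributed as $\mathcal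 N(0,I_p)$, independent of $(x,v)$, and let $\varepsilon_S(p_S,n)=\mathbb{E}_A[J_S(W_S)]\in[0,+\infty]$ be the expected MSE. Suppose that, for real $\sigma_x,\sigma_v$, $\operatorname{tr}(K_{x_S})=\sigma_x^2p_S>0$, $\operatorname{tr}(K_{x_C})=\sigma_x^2p_C\ge 0$ and $\operatorname{tr}(K_v)=n\sigma_v^2>0$. Then $$\varepsilon_S(p_S,n)=\sigma_x^2\,(p_S-\min\{p_S,n\})+\gamma\,(\sigma_x^2p_C+\sigma_v^2),$$ where $$\gamma=\begin{cases}\dfrac{p_S}{n-p_S-1}&\text{if }p_S<n-1,\\[1ex]\dfrac{n}{p_S-n-1}&\text{if }p_S>n+1,\\[1ex]+\infty&\text{otherwise.}\end{cases}$$ -/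

import Mathlib

open MeasureTheory ProbabilityTheory

open scoped ENNReal Matrix

noncomputable section

namespace PartialLMMSE

/-! ### The Moore-Penrose pseudoinverse of a real matrix -/

section Pinv

variable {m n : Type*} [Fintype m] [Fintype n]

/-- The four Penrose conditions: `X` is the Moore-Penrose pseudoinverse of `A`. -/
structure IsMoorePenrose (A : Matrix m n ℝ) (X : Matrix n m ℝ) : Prop where
  mul_mul_left : A * X * A = A
  mul_mul_right : X * A * X = X
  symm_left : (A * X)ᵀ = A * X
  symm_right : (X * A)ᵀ = X * A

theorem IsMoorePenrose.unique {A : Matrix m n ℝ} {X Y : Matrix n m ℝ}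
    (hX : IsMoorePenrose A X) (hY : IsMoorePenrose A Y) : X = Y := by
  have h1 : A * X = A * Y := by
    calc A * X = (A * X)ᵀ := hX.symm_left.symm
      _ = ((A * Y * A) * X)ᵀ := by rw [hY.mul_mul_left]
      _ = (A * X)ᵀ * (A * Y)ᵀ := by rw [← Matrix.transpose_mul, ← Matrix.mul_assoc]
      _ = A * X * (A * Y) := by rw [hX.symm_left, hY.symm_left]
      _ = A * X * A * Y := by rw [← Matrix.mul_assoc]
      _ = A * Y := by rw [hX.mul_mul_left]
  have h2 : X * A = Y * A := by
    calc X * A = (X * A)ᵀ := hX.symm_right.symm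
      _ = (X * (A * Y * A))ᵀ := by rw [hY.mul_mul_left]
      _ = (Y * A)ᵀ * (X * A)ᵀ := by
          rw [← Matrix.transpose_mul]; simp only [Matrix.mul_assoc]
      _ = Y * A * (X * A) := by rw [hX.symm_right, hY.symm_right]
      _ = Y * (A * X * A) := by simp only [Matrix.mul_assoc]
      _ = Y * A := by rw [hX.mul_mul_left]
  calc X = X * A * X := hX.mul_mul_right.symm
    _ = Y * A * X := by rw [h2]
    _ = Y * (A * X) := Matrix.mul_assoc _ _ _
    _ = Y * A * Y := by rw [h1, Matrix.mul_assoc]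
    _ = Y := hY.mul_mul_right

theorem exists_isMoorePenrose_of_isHermitian (B : Matrix n n ℝ) (hB : B.IsHermitian) :
    ∃ C : Matrix n n ℝ, B * C * B = B ∧ C * B * C = C ∧ Cᵀ = C ∧ B * C = C * B := by
  classical
  let V : Matrix n n ℝ := (hB.eigenvectorUnitary : Matrix n n ℝ)
  have hV : star V * V = 1 := Unitary.coe_star_mul_self hB.eigenvectorUnitary
  let d : n → ℝ := hB.eigenvalues
  have hBd : B = V * Matrix.diagonal d * star V := by
    have h := hB.spectral_theorem
    rw [Unitary.conjStarAlgAut_apply] at h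
    exact h
  have key : ∀ e f : n → ℝ, (V * Matrix.diagonal e * star V) * (V * Matrix.diagonal f * star V)
      = V * Matrix.diagonal (fun i => e i * f i) * star V := by
    intro e f
    calc _ = V * Matrix.diagonal e * (star V * V) * Matrix.diagonal f * star V := by
          simp only [Matrix.mul_assoc]
      _ = _ := by
          rw [hV, Matrix.mul_one, Matrix.mul_assoc V, Matrix.diagonal_mul_diagonal]
  refine ⟨V * Matrix.diagonal (fun i => (d i)⁻¹) * star V, ?_, ?_, ?_, ?_⟩
  · conv_rhs => rw [hBd]
    rw [hBd, key, key]
    congr 3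
    funext i
    exact mul_inv_mul_cancel (d i)
  · rw [hBd, key, key]
    congr 3
    funext i
    have := mul_inv_mul_cancel (d i)⁻¹
    rwa [inv_inv] at this
  · simp [Matrix.transpose_mul, Matrix.star_eq_conjTranspose, Matrix.conjTranspose_eq_transpose_of_trivial,
      Matrix.mul_assoc]
  · rw [hBd, key, key]
    congr 3
    funext i
    exact mul_comm _ _

/-- Every real matrix has a Moore-Penrose pseudoinverse. -/
theorem exists_isMoorePenrose (A : Matrix m n ℝ) :
    ∃ X : Matrix n m ℝ, IsMoorePenrose A X := by
  classical
  have hB : (Aᵀ * A).IsHermitian := by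
    simpa [Matrix.conjTranspose_eq_transpose_of_trivial] using
      Matrix.isHermitian_conjTranspose_mul_self A
  obtain ⟨C, h1, h2, h3, h4⟩ := exists_isMoorePenrose_of_isHermitian _ hB
  refine ⟨C * Aᵀ, ?_, ?_, ?_, ?_⟩
  · have h0 : (A * (C * (Aᵀ * A)) - A)ᵀ * (A * (C * (Aᵀ * A)) - A) = 0 := by
      have : Aᵀ * (A * (C * (Aᵀ * A)) - A) = 0 := by
        rw [Matrix.mul_sub, sub_eq_zero]
        simpa only [Matrix.mul_assoc] using h1
      have hf : (A * (C * (Aᵀ * A)) - A)ᵀ = (C * (Aᵀ * A) - 1)ᵀ * Aᵀ := by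
        rw [← Matrix.transpose_mul, Matrix.mul_sub, Matrix.mul_one]
      rw [hf, Matrix.mul_assoc, this, Matrix.mul_zero]
    rw [← Matrix.conjTranspose_eq_transpose_of_trivial,
      Matrix.conjTranspose_mul_self_eq_zero, sub_eq_zero] at h0
    simpa only [Matrix.mul_assoc] using h0
  · calc C * Aᵀ * A * (C * Aᵀ) = C * (Aᵀ * A) * C * Aᵀ := by simp only [Matrix.mul_assoc]
      _ = C * Aᵀ := by rw [h2]
  · simp only [Matrix.transpose_mul, Matrix.transpose_transpose, h3, Matrix.mul_assoc]
  · have : C * Aᵀ * A = C * (Aᵀ * A) := Matrix.mul_assoc _ _ _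
    rw [this, Matrix.transpose_mul, h3, Matrix.transpose_mul, Matrix.transpose_transpose, h4]

/-- The Moore-Penrose pseudoinverse `A⁺` of a real matrix `A`. -/
def pinv (A : Matrix m n ℝ) : Matrix n m ℝ := Classical.choose (exists_isMoorePenrose A)

theorem pinv_spec (A : Matrix m n ℝ) : IsMoorePenrose A (pinv A) :=
  Classical.choose_spec (exists_isMoorePenrose A)

end Pinv

/-! ### Covariance matrices -/

/-- The covariance matrix `K_{zw} = E[(z - E z)(w - E w)ᵀ]` of two random vectors. -/
def covMatrix {Ω ι κ : Type*} [MeasurableSpace Ω] (P : Measure Ω)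
    (z : Ω → EuclideanSpace ℝ ι) (w : Ω → EuclideanSpace ℝ κ) : Matrix ι κ ℝ :=
  Matrix.of fun i j => covariance (fun ω => z ω i) (fun ω => w ω j) P

/-! ### The underlying system and the mismatched estimator -/

section Model

variable {n p : ℕ}

/-- The subvector `x_S` of `x` with the entries indexed by `S`. -/
def subvec (S : Finset (Fin p)) (x : EuclideanSpace ℝ (Fin p)) : EuclideanSpace ℝ S :=
  WithLp.toLp 2 fun i => x i

/-- The submatrix `A_S` of `A` with the columns indexed by `S`. -/
def subcols (S : Finset (Fin p)) (A : Matrix (Fin n) (Fin p) ℝ) : Matrix (Fin n) S ℝ :=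
  A.submatrix id (fun i : S => (i : Fin p))

/-- The observations `y = A x + v`. -/
def obs (A : Matrix (Fin n) (Fin p) ℝ) (x : EuclideanSpace ℝ (Fin p))
    (v : EuclideanSpace ℝ (Fin n)) : EuclideanSpace ℝ (Fin n) :=
  WithLp.toLp 2 (A *ᵥ x.ofLp + v.ofLp)

/-- The matrix `W_S = K̂_{x_S} A_Sᵀ (A_S K̂_{x_S} A_Sᵀ + K̂_z)⁺` of the LMMSE estimator of `x_S`
that is based on the assumed model `y = A_S x_S + z` with assumed covariances `K̂_{x_S}`, `K̂_z`. -/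
def partialLMMSE {S : Finset (Fin p)} (KxS : Matrix S S ℝ) (Kz : Matrix (Fin n) (Fin n) ℝ)
    (AS : Matrix (Fin n) S ℝ) : Matrix S (Fin n) ℝ :=
  KxS * ASᵀ * pinv (AS * KxS * ASᵀ + Kz)

variable {Ω Ω' : Type*} [MeasurableSpace Ω] [MeasurableSpace Ω']

/-- The mean squared error `J_S(W) = E_{x,v} ‖x_S - W y‖²` of the linear estimate `W y` of `x_S`,
where `y = A x + v` comes from the underlying system with regressor matrix `A`; the expectation of
a nonnegative random variable, with values in `[0, ∞]`. -/
def mse (P : Measure Ω) (x : Ω → EuclideanSpace ℝ (Fin p)) (v : Ω → EuclideanSpace ℝ (Fin n))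
    (S : Finset (Fin p)) (A : Matrix (Fin n) (Fin p) ℝ) (W : Matrix S (Fin n) ℝ) : ℝ≥0∞ :=
  ∫⁻ ω, ENNReal.ofReal
    (‖subvec S (x ω) - WithLp.toLp 2 (W *ᵥ (obs A (x ω) (v ω)).ofLp)‖ ^ 2) ∂P

/-- The expected MSE `ε_S = E_A [J_S(W_S)]` of the partial LMMSE estimator over the
distribution of the random regressor matrix `A`. -/
def expectedMSE (P : Measure Ω) (x : Ω → EuclideanSpace ℝ (Fin p))
    (v : Ω → EuclideanSpace ℝ (Fin n)) (P' : Measure Ω') (A : Ω' → Matrix (Fin n) (Fin p) ℝ)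
    (S : Finset (Fin p)) (KxS : Matrix S S ℝ) (Kz : Matrix (Fin n) (Fin n) ℝ) : ℝ≥0∞ :=
  ∫⁻ ω', mse P x v S (A ω') (partialLMMSE KxS Kz (subcols S (A ω'))) ∂P'

end Model

/-- The factor `γ`, equal to `p_S / (n - p_S - 1)` for `p_S < n - 1`, to `n / (p_S - n - 1)` for
`p_S > n + 1`, and to `+∞` otherwise. -/
def gam (pS n : ℕ) : ℝ≥0∞ :=
  if pS + 1 < n then ENNReal.ofReal ((pS : ℝ) / ((n : ℝ) - pS - 1))
  else if n + 1 < pS then ENNReal.ofReal ((n : ℝ) / ((pS : ℝ) - n - 1))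
  else ∞

end PartialLMMSE

end

/-! With unit assumed covariance and no assumed noise, `W_S = Bᵀ (B Bᵀ)⁺ = B⁺`, where `B = A_S`. Put
`D = A_C`. The error is `(1 - B⁺B) x_S - B⁺ (D x_C + v)`. Its first part lies in the kernel of `B`
and its second in the row space, so by Pythagoras the squared norms add for every realization
(`norm_sq_error_eq`). The integrand is nonnegative, so Tonelli allows averaging over `A` first with
`x` and `v` frozen.

Both averages over `B` follow from rotation invariance of the Gaussian law: an invariant function,
homogeneous of degree two, is determined by its sum over a basis (`card_mul_eq_of_isotropic`). For
the first part that sum is the trace of `1 - B⁺B`, which is `p_S - min p_S n` because `B` almost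
surely has full rank. For the second part it is the expected squared Frobenius norm of `B⁺`, so
`‖B⁺u‖²` averages to `‖u‖² / n` times this energy. As `D` is independent of `B`, `u = D x_C + v` has
mean squared norm `n ‖x_C‖² + ‖v‖²`; the traces then finish the computation.

The energy is the source of `γ` (`pinvEnergy_eq_gam`). For `m` rows and `k ≥ m` columns, the squared
norm of a column of the pseudoinverse is the inverse squared distance of a row to the span of the
others (`sum_sq_pinv_col`). Given the other rows, that squared distance is chi-square with `k - m +
1` degrees of freedom, whose inverse has mean `1 / (k - m - 1)`, or `∞` if there are at most two
degrees. Transposition covers `m ≥ k`. -/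

namespace PartialLMMSE

/-! ### Algebra of the pseudoinverse -/

section PinvAlgebra

variable {m k : Type*} [Fintype m] [Fintype k]

theorem pinv_eq {A : Matrix m k ℝ} {X : Matrix k m ℝ} (h : IsMoorePenrose A X) : pinv A = X :=
  (pinv_spec A).unique h

theorem IsMoorePenrose.transpose {A : Matrix m k ℝ} {X : Matrix k m ℝ}
    (h : IsMoorePenrose A X) : IsMoorePenrose Aᵀ Xᵀ where
  mul_mul_left := by
    rw [← Matrix.transpose_mul, ← Matrix.transpose_mul, ← Matrix.mul_assoc, h.mul_mul_left]
  mul_mul_right := by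
    rw [← Matrix.transpose_mul, ← Matrix.transpose_mul, ← Matrix.mul_assoc, h.mul_mul_right]
  symm_left := by rw [← Matrix.transpose_mul, h.symm_right, h.symm_right]
  symm_right := by rw [← Matrix.transpose_mul, h.symm_left, h.symm_left]

theorem pinv_transpose (A : Matrix m k ℝ) : pinv Aᵀ = (pinv A)ᵀ :=
  pinv_eq (pinv_spec A).transpose

/-- `Aᵀ = A⁺ A Aᵀ`. -/
theorem pinv_mul_mul_transpose (A : Matrix m k ℝ) : pinv A * (A * Aᵀ) = Aᵀ := by
  have h := pinv_spec A
  rw [← Matrix.mul_assoc, ← h.symm_right, ← Matrix.transpose_mul, ← Matrix.mul_assoc,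
    h.mul_mul_left]

/-- `A⁺ = Aᵀ (A⁺)ᵀ A⁺`. -/
theorem pinv_eq_transpose_mul (A : Matrix m k ℝ) : pinv A = Aᵀ * ((pinv A)ᵀ * pinv A) := by
  have h := pinv_spec A
  rw [← Matrix.mul_assoc, ← Matrix.transpose_mul, h.symm_right, h.mul_mul_right]

/-- `A⁺ = A⁺ (A⁺)ᵀ Aᵀ`. -/
theorem pinv_eq_mul_transpose (A : Matrix m k ℝ) : pinv A = pinv A * (pinv A)ᵀ * Aᵀ := by
  have h := pinv_spec A
  rw [Matrix.mul_assoc, ← Matrix.transpose_mul, h.symm_left, ← Matrix.mul_assoc, h.mul_mul_right]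

/-- Factoring `A⁺` through `A Aᵀ` is what keeps `A⁺ (A Aᵀ + ε)⁻¹` bounded as `ε → 0`, even for
singular `A Aᵀ`. -/
theorem pinv_eq_mul_gram (A : Matrix m k ℝ) :
    pinv A = pinv A * (pinv A)ᵀ * pinv A * (A * Aᵀ) := by
  rw [Matrix.mul_assoc _ (pinv A), pinv_mul_mul_transpose, ← pinv_eq_mul_transpose]

/-- `Aᵀ (A Aᵀ)⁺ = A⁺`. -/
theorem transpose_mul_pinv_mul_transpose (A : Matrix m k ℝ) :
    Aᵀ * pinv (A * Aᵀ) = pinv A := by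
  have h := pinv_spec A
  have h1 : pinv (A * Aᵀ) = (pinv A)ᵀ * pinv A := by
    apply pinv_eq
    have e1 : A * Aᵀ * ((pinv A)ᵀ * pinv A) = A * pinv A := by
      rw [Matrix.mul_assoc, ← pinv_eq_transpose_mul]
    have e2 : (pinv A)ᵀ * pinv A * (A * Aᵀ) = A * pinv A := by
      rw [Matrix.mul_assoc, pinv_mul_mul_transpose, ← Matrix.transpose_mul, h.symm_left]
    refine ⟨?_, ?_, ?_, ?_⟩
    · rw [e1, ← Matrix.mul_assoc, h.mul_mul_left]
    · rw [e2, ← Matrix.mul_assoc, ← h.symm_left, ← Matrix.transpose_mul, ← Matrix.mul_assoc,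
        h.mul_mul_right]
    · rw [e1, h.symm_left]
    · rw [e2, h.symm_left]
  rw [h1, ← pinv_eq_transpose_mul]

theorem pinv_mul_orthogonal [DecidableEq k] (A : Matrix m k ℝ) {R : Matrix k k ℝ}
    (hR : Rᵀ * R = 1) : pinv (A * R) = Rᵀ * pinv A := by
  have h := pinv_spec A
  have hR' : R * Rᵀ = 1 := mul_eq_one_comm.mp hR
  have e1 : A * R * (Rᵀ * pinv A) = A * pinv A := by
    rw [Matrix.mul_assoc, ← Matrix.mul_assoc R, hR', Matrix.one_mul]
  apply pinv_eq
  refine ⟨?_, ?_, ?_, ?_⟩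
  · rw [e1, ← Matrix.mul_assoc, h.mul_mul_left]
  · rw [Matrix.mul_assoc, e1, Matrix.mul_assoc, ← Matrix.mul_assoc (pinv A), h.mul_mul_right]
  · rw [e1, h.symm_left]
  · have : Rᵀ * pinv A * (A * R) = Rᵀ * (pinv A * A) * R := by simp only [Matrix.mul_assoc]
    rw [this, Matrix.transpose_mul, Matrix.transpose_mul, h.symm_right, Matrix.transpose_transpose]
    simp only [Matrix.mul_assoc]

theorem pinv_orthogonal_mul [DecidableEq m] (A : Matrix m k ℝ) {Q : Matrix m m ℝ}
    (hQ : Qᵀ * Q = 1) : pinv (Q * A) = pinv A * Qᵀ := by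
  have hQ' : Qᵀᵀ * Qᵀ = 1 := by
    rw [Matrix.transpose_transpose]; exact mul_eq_one_comm.mp hQ
  have := pinv_mul_orthogonal Aᵀ hQ'
  rw [← Matrix.transpose_mul, pinv_transpose, pinv_transpose, ← Matrix.transpose_mul] at this
  exact Matrix.transpose_injective this

/-- If the rows of `A` are linearly independent, `A⁺` is a right inverse of `A`. -/
theorem mul_pinv_of_linearIndependent [DecidableEq m] {A : Matrix m k ℝ}
    (hA : LinearIndependent ℝ A.row) : A * pinv A = 1 := by
  have h0 : (A * pinv A - 1) * A = 0 := by
    rw [Matrix.sub_mul, (pinv_spec A).mul_mul_left, Matrix.one_mul, sub_self]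
  rw [← Matrix.vecMul_injective_iff] at hA
  rw [← sub_eq_zero]
  funext i
  apply hA
  have := congrFun h0 i
  simp only [Matrix.mul_apply_eq_vecMul] at this
  exact this.trans (Matrix.zero_vecMul A).symm

end PinvAlgebra

/-! ### Measurability of the pseudoinverse by Tikhonov regularization -/

section PinvMeasurable

variable {m k : Type*} [Fintype m] [Fintype k] [DecidableEq m]

theorem isUnit_det_gram_add (A : Matrix m k ℝ) {ε : ℝ} (hε : 0 < ε) :
    IsUnit (A * Aᵀ + ε • (1 : Matrix m m ℝ)).det := by
  have h1 : (A * Aᵀ).PosSemidef := by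
    simpa [Matrix.conjTranspose_eq_transpose_of_trivial] using
      Matrix.posSemidef_self_mul_conjTranspose A
  have h2 : (ε • (1 : Matrix m m ℝ)).PosDef := Matrix.PosDef.one.smul hε
  exact (h2.posSemidef_add h1).det_pos.ne'.isUnit

/-- The resolvent `ε (A Aᵀ + ε)⁻¹` is a contraction. -/
theorem abs_resolvent_apply_le_one (A : Matrix m k ℝ) {ε : ℝ} (hε : 0 < ε) (i j : m) :
    |(ε • (A * Aᵀ + ε • (1 : Matrix m m ℝ))⁻¹) i j| ≤ 1 := by
  set B := A * Aᵀ + ε • (1 : Matrix m m ℝ) with hB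
  -- Testing `B w = ε e_j` against `w` gives `‖Aᵀw‖² + ε ‖w‖² = ε w_j`. Hence `w_j² ≤ ‖w‖² ≤ w_j`,
  -- which bounds first `w_j` and then every entry by one.
  set w : m → ℝ := fun i => (ε • B⁻¹) i j with hw
  have hBw : B *ᵥ w = ε • Pi.single j 1 := by
    have : B * (ε • B⁻¹) = ε • 1 := by
      rw [Matrix.mul_smul, Matrix.mul_nonsing_inv _ (isUnit_det_gram_add A hε)]
    ext i
    have := congrFun (congrFun this i) j
    simpa [Matrix.mul_apply, Matrix.mulVec, dotProduct, hw, Matrix.one_apply, Pi.single_apply]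
      using this
  have h1 : w ⬝ᵥ (B *ᵥ w) = ε * w j := by
    rw [hBw]; simp
  have h2 : w ⬝ᵥ (B *ᵥ w) = (Aᵀ *ᵥ w) ⬝ᵥ (Aᵀ *ᵥ w) + ε * (w ⬝ᵥ w) := by
    rw [hB, Matrix.add_mulVec, dotProduct_add, Matrix.smul_mulVec, Matrix.one_mulVec,
      dotProduct_smul, ← Matrix.mulVec_mulVec, Matrix.dotProduct_mulVec, ← Matrix.mulVec_transpose,
      smul_eq_mul]
  have h3 : 0 ≤ (Aᵀ *ᵥ w) ⬝ᵥ (Aᵀ *ᵥ w) := by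
    exact Finset.sum_nonneg fun i _ => mul_self_nonneg _
  have h4 : w ⬝ᵥ w ≤ w j := by
    have : ε * (w ⬝ᵥ w) ≤ ε * w j := by linarith
    exact le_of_mul_le_mul_left this hε
  have h5 : ∀ l, w l * w l ≤ w ⬝ᵥ w := fun l =>
    Finset.single_le_sum (f := fun l => w l * w l) (fun i _ => mul_self_nonneg _)
      (Finset.mem_univ l)
  have h6 : w j ≤ 1 := by nlinarith [h5 j]
  have h7 : w i * w i ≤ 1 := by linarith [h5 i]
  exact abs_le_one_iff_mul_self_le_one.mpr h7

/-- The difference from `A⁺` is `ε` times `Y - Y (ε (A Aᵀ + ε)⁻¹)`, which stays bounded because the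
resolvent entries are at most one in absolute value. -/
theorem tendsto_regularized_pinv (A : Matrix m k ℝ) (l : k) (i : m) :
    Filter.Tendsto (fun N : ℕ => (Aᵀ * (A * Aᵀ + (1 / ((N : ℝ) + 1)) • (1 : Matrix m m ℝ))⁻¹) l i)
      Filter.atTop (nhds (pinv A l i)) := by
  set Y := pinv A * (pinv A)ᵀ * pinv A with hY
  have key : ∀ ε : ℝ, 0 < ε → (Aᵀ * (A * Aᵀ + ε • (1 : Matrix m m ℝ))⁻¹) l i
      = pinv A l i - ε * (Y l i - (Y * (ε • (A * Aᵀ + ε • (1 : Matrix m m ℝ))⁻¹)) l i) := by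
    intro ε hε
    set B := A * Aᵀ + ε • (1 : Matrix m m ℝ) with hB
    have hBi : B * B⁻¹ = 1 := Matrix.mul_nonsing_inv _ (isUnit_det_gram_add A hε)
    have hG : A * Aᵀ = B - ε • 1 := by rw [hB, add_sub_cancel_right]
    have hA : Aᵀ * B⁻¹ = pinv A - ε • (Y - Y * (ε • B⁻¹)) := by
      have e1 : A * Aᵀ * B⁻¹ = 1 - ε • B⁻¹ := by
        rw [hG, Matrix.sub_mul, hBi, Matrix.smul_mul, Matrix.one_mul]
      calc Aᵀ * B⁻¹ = pinv A * (A * Aᵀ * B⁻¹) := by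
            rw [← Matrix.mul_assoc, pinv_mul_mul_transpose]
        _ = pinv A - ε • (pinv A * B⁻¹) := by
            rw [e1, Matrix.mul_sub, Matrix.mul_one, Matrix.mul_smul]
        _ = pinv A - ε • (Y * (A * Aᵀ * B⁻¹)) := by
            rw [← Matrix.mul_assoc Y, ← pinv_eq_mul_gram]
        _ = _ := by rw [e1, Matrix.mul_sub, Matrix.mul_one]
    rw [hA]; simp
  have hb : ∀ ε : ℝ, 0 < ε →
      |Y l i - (Y * (ε • (A * Aᵀ + ε • (1 : Matrix m m ℝ))⁻¹)) l i| ≤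
        |Y l i| + ∑ j, |Y l j| := by
    intro ε hε
    refine (abs_sub _ _).trans (add_le_add le_rfl ?_)
    rw [Matrix.mul_apply]
    refine (Finset.abs_sum_le_sum_abs _ _).trans (Finset.sum_le_sum fun j _ => ?_)
    rw [abs_mul]
    exact mul_le_of_le_one_right (abs_nonneg _) (abs_resolvent_apply_le_one A hε j i)
  have hpos : ∀ N : ℕ, 0 < 1 / ((N : ℝ) + 1) := fun N => by positivity
  have h0 := tendsto_one_div_add_atTop_nhds_zero_nat (𝕜 := ℝ)
  have h1 : Filter.Tendsto (fun N : ℕ => (1 / ((N : ℝ) + 1)) * (Y l i - (Y * ((1 / ((N : ℝ) + 1)) •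
      (A * Aᵀ + (1 / ((N : ℝ) + 1)) • (1 : Matrix m m ℝ))⁻¹)) l i)) Filter.atTop (nhds 0) := by
    refine squeeze_zero_norm (a := fun N : ℕ => (1 / ((N : ℝ) + 1)) * (|Y l i| + ∑ j, |Y l j|))
      (fun N => ?_) ?_
    · rw [Real.norm_eq_abs, abs_mul, abs_of_pos (hpos N)]
      exact mul_le_mul_of_nonneg_left (hb _ (hpos N)) (hpos N).le
    · simpa using h0.mul_const (|Y l i| + ∑ j, |Y l j|)
  have h2 := (tendsto_const_nhds (x := pinv A l i)).sub h1
  rw [sub_zero] at h2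
  exact h2.congr fun N => (key _ (hpos N)).symm

-- The pseudoinverse jumps where the rank drops, so continuity is not available; it is instead a
-- pointwise limit of measurable functions.
omit [DecidableEq m] in
theorem measurable_pinv_apply (l : k) (i : m) :
    Measurable fun M : m → k → ℝ => pinv (Matrix.of M) l i := by
  classical
  refine measurable_of_tendsto_metrizable (f := fun (N : ℕ) (M : m → k → ℝ) =>
    ((Matrix.of M)ᵀ * ((Matrix.of M) * (Matrix.of M)ᵀ +
      (1 / ((N : ℝ) + 1)) • (1 : Matrix m m ℝ))⁻¹) l i) (fun N => ?_)
    (tendsto_pi_nhds.mpr fun M => tendsto_regularized_pinv _ _ _)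
  have hc : Continuous fun M : m → k → ℝ => (Matrix.of M) * (Matrix.of M)ᵀ +
      (1 / ((N : ℝ) + 1)) • (1 : Matrix m m ℝ) := by
    have : Continuous fun M : m → k → ℝ => (Matrix.of M) := continuous_id
    fun_prop
  simp only [Matrix.mul_apply, Matrix.inv_def, Matrix.smul_apply, smul_eq_mul,
    Ring.inverse_eq_inv']
  refine Finset.measurable_sum _ fun j _ => Measurable.mul ?_ (Measurable.mul ?_ ?_)
  · simp only [Matrix.transpose_apply, Matrix.of_apply]
    fun_prop
  · exact hc.matrix_det.measurable.inv
  · exact ((continuous_apply_apply j i).comp hc.matrix_adjugate).measurable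

end PinvMeasurable

/-! ### Columns of the pseudoinverse and distances between rows -/

section PinvColumn

variable {m k : Type*} [Fintype m] [Fintype k]

/-- The `i`-th row of a matrix as a Euclidean vector. -/
def rowVec (M : m → k → ℝ) (i : m) : EuclideanSpace ℝ k := WithLp.toLp 2 (M i)

/-- The span of all rows but the `i`-th. -/
def otherRows (M : m → k → ℝ) (i : m) : Submodule ℝ (EuclideanSpace ℝ k) :=
  Submodule.span ℝ (rowVec M '' (Set.univ \ {i}))

omit [Fintype m] [Fintype k] in
theorem linearIndependent_row_iff (M : m → k → ℝ) :
    LinearIndependent ℝ (Matrix.of M).row ↔ LinearIndependent ℝ (rowVec M) := by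
  have : rowVec M = (WithLp.linearEquiv 2 ℝ (k → ℝ)).symm.toLinearMap ∘ (Matrix.of M).row := rfl
  rw [this, LinearMap.linearIndependent_iff _ (LinearEquiv.ker _)]

omit [Fintype m] [Fintype k] in
theorem otherRows_update [DecidableEq m] (M : m → k → ℝ) (i : m) (r : k → ℝ) :
    otherRows (Function.update M i r) i = otherRows M i := by
  unfold otherRows
  congr 1
  apply Set.image_congr
  intro j hj
  have : j ≠ i := by simpa using hj
  simp [rowVec, Function.update_of_ne this]

theorem finrank_otherRows_lt (M : m → k → ℝ) (i : m) :
    Module.finrank ℝ (otherRows M i) < Fintype.card m := by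
  classical
  unfold otherRows
  have h : rowVec M '' (Set.univ \ {i}) = ((Finset.univ.erase i).image (rowVec M) : Finset _) := by
    ext; simp
  rw [h]
  refine (finrank_span_finset_le_card _).trans_lt (Finset.card_image_le.trans_lt ?_)
  exact Finset.card_lt_card (Finset.erase_ssubset (Finset.mem_univ i))

omit [Fintype k] in
theorem finrank_otherRows {M : m → k → ℝ} (hM : LinearIndependent ℝ (rowVec M)) (i : m) :
    Module.finrank ℝ (otherRows M i) + 1 = Fintype.card m := by
  classical
  have h : otherRows M i
      = Submodule.span ℝ (Set.range fun j : {j : m // j ≠ i} => rowVec M j) := by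
    unfold otherRows
    congr 1
    ext; simp
  have hLI : LinearIndependent ℝ fun j : {j : m // j ≠ i} => rowVec M j :=
    hM.comp _ Subtype.val_injective
  rw [h, finrank_span_eq_card hLI, Fintype.card_subtype_compl, Fintype.card_subtype_eq]
  have : 0 < Fintype.card m := Fintype.card_pos_iff.mpr ⟨i⟩
  omega

/-- The squared norm of the `i`-th column of `M⁺` is the inverse squared distance of the `i`-th row
of `M` to the span of the others. -/
theorem sum_sq_pinv_col {M : m → k → ℝ} (hM : LinearIndependent ℝ (rowVec M)) (i : m) :
    (∑ l, pinv (Matrix.of M) l i ^ 2) *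
      ‖(otherRows M i)ᗮ.starProjection (rowVec M i)‖ ^ 2 = 1 := by
  classical
  set X := pinv (Matrix.of M) with hX
  set U := otherRows M i with hU
  set w : EuclideanSpace ℝ k := WithLp.toLp 2 fun l => X l i with hw
  have h1 : Matrix.of M * X = 1 :=
    mul_pinv_of_linearIndependent ((linearIndependent_row_iff M).mpr hM)
  have hr : ∀ j, inner ℝ (rowVec M j) w = if j = i then 1 else 0 := by
    intro j
    have := congrFun (congrFun h1 j) i
    rw [Matrix.mul_apply, Matrix.one_apply] at this
    rw [← this]
    simp [PiLp.inner_apply, rowVec, hw, mul_comm]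
  have hww : ∑ l, X l i ^ 2 = ‖w‖ ^ 2 := by
    rw [EuclideanSpace.real_norm_sq_eq]
  -- `A⁺ = Aᵀ (A⁺)ᵀ A⁺` writes the column `w` as a combination of rows of `M`; its `i`-th
  -- coefficient is `‖w‖²` itself.
  set c : m → ℝ := fun j => (Xᵀ * X) j i with hc
  have hwc : w = ∑ j, c j • rowVec M j := by
    ext l
    have := congrFun (congrFun (pinv_eq_transpose_mul (Matrix.of M)) l) i
    rw [← hX, Matrix.mul_apply] at this
    simp only [hw, this, rowVec, hc, WithLp.ofLp_sum, WithLp.ofLp_smul, Finset.sum_apply,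
      Pi.smul_apply, smul_eq_mul, Matrix.transpose_apply, Matrix.of_apply]
    exact Finset.sum_congr rfl fun j _ => mul_comm _ _
  have hwU : w ∈ Uᗮ := by
    rw [Submodule.mem_orthogonal]
    intro u hu
    induction hu using Submodule.span_induction with
    | mem y hy =>
      obtain ⟨j, hj, rfl⟩ := hy
      rw [hr, if_neg (by simpa using hj)]
    | zero => exact inner_zero_left _
    | add y z _ _ hy hz => rw [inner_add_left, hy, hz, add_zero]
    | smul a y _ hy => rw [inner_smul_left, hy, mul_zero]
  -- Projecting onto `Uᗮ` fixes `w` and kills every row but the `i`-th.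
  have hproj : w = c i • Uᗮ.starProjection (rowVec M i) := by
    conv_lhs => rw [← Submodule.starProjection_eq_self_iff.mpr hwU, hwc]
    rw [map_sum, Finset.sum_eq_single i]
    · rw [map_smul]
    · intro j _ hj
      have : rowVec M j ∈ U := Submodule.subset_span ⟨j, by simpa using hj, rfl⟩
      rw [map_smul, Submodule.starProjection_orthogonal_apply_eq_zero this, smul_zero]
    · simp
  have hci : c i = ∑ l, X l i ^ 2 := by
    simp only [hc, Matrix.mul_apply, Matrix.transpose_apply, sq]
  have h2 : inner ℝ (Uᗮ.starProjection (rowVec M i)) w = 1 := by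
    rw [Submodule.inner_starProjection_left_eq_right, Submodule.starProjection_eq_self_iff.mpr hwU,
      hr, if_pos rfl]
  rw [hproj, inner_smul_right, real_inner_self_eq_norm_sq, hci] at h2
  exact h2

end PinvColumn

/-! ### Invariances of the Gaussian matrix law -/

section GaussianMatrix

variable (m k : Type*) [Fintype m] [Fintype k]

/-- The law of a random matrix with i.i.d. standard Gaussian entries. -/
noncomputable def gaussianMatrix : Measure (m → k → ℝ) :=
  Measure.pi fun _ => Measure.pi fun _ => gaussianReal 0 1

instance : IsProbabilityMeasure (gaussianMatrix m k) := by
  unfold gaussianMatrix; infer_instance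

/-- Both laws are curried forms of one product measure over pairs of indices, and transposition only
swaps the pair. -/
theorem measurePreserving_transpose :
    MeasurePreserving (fun (M : m → k → ℝ) (j : k) (i : m) => M i j)
      (gaussianMatrix m k) (gaussianMatrix k m) := by
  have hG' : MeasurePreserving (MeasurableEquiv.curry m k ℝ).symm
        (gaussianMatrix m k) (Measure.pi fun _ => gaussianReal 0 1) := by
    refine ⟨by fun_prop, ?_⟩
    have h := Measure.infinitePi_map_curry_symm (fun (_ : m) (_ : k) => gaussianReal 0 1)
    simp only [Measure.infinitePi_eq_pi] at h
    exact h
  have hs := measurePreserving_piCongrLeft (α := fun _ : k × m => ℝ)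
    (fun _ => gaussianReal 0 1) (Equiv.prodComm m k)
  have hk : MeasurePreserving (fun (f : k × m → ℝ) i j => f (i, j))
        (Measure.pi fun _ => gaussianReal 0 1) (gaussianMatrix k m) := by
    refine ⟨by fun_prop, ?_⟩
    have h := Measure.infinitePi_map_curry (fun (_ : k) (_ : m) => gaussianReal 0 1)
    simp only [Measure.infinitePi_eq_pi] at h
    exact h
  have := hk.comp (hs.comp hG')
  convert this using 1
  funext M j i
  simp [MeasurableEquiv.piCongrLeft, Equiv.piCongrLeft]

variable {m k}

theorem measurePreserving_ofLp_stdGaussian :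
    MeasurePreserving (WithLp.ofLp : EuclideanSpace ℝ k → (k → ℝ))
      (stdGaussian (EuclideanSpace ℝ k)) (Measure.pi fun _ => gaussianReal 0 1) := by
  refine ⟨by fun_prop, ?_⟩
  rw [← map_pi_eq_stdGaussian, Measure.map_map (by fun_prop) (by fun_prop)]
  exact Measure.map_id

theorem measurePreserving_orthogonal_mulVec [DecidableEq k] {R : Matrix k k ℝ}
    (hR : Rᵀ * R = 1) :
    MeasurePreserving (fun r : k → ℝ => R *ᵥ r) (Measure.pi fun _ => gaussianReal 0 1)
      (Measure.pi fun _ => gaussianReal 0 1) := by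
  let f : EuclideanSpace ℝ k →ₗᵢ[ℝ] EuclideanSpace ℝ k :=
    { toLinearMap := Matrix.toEuclideanLin R
      norm_map' := fun x => by
        rw [← sq_eq_sq₀ (norm_nonneg _) (norm_nonneg _), ← real_inner_self_eq_norm_sq,
          ← real_inner_self_eq_norm_sq, EuclideanSpace.inner_eq_star_dotProduct,
          EuclideanSpace.inner_eq_star_dotProduct]
        simp only [Matrix.ofLp_toLpLin, Matrix.toLin'_apply, star_trivial]
        rw [Matrix.dotProduct_mulVec, ← Matrix.mulVec_transpose, Matrix.mulVec_mulVec, hR,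
          Matrix.one_mulVec] }
  let e := f.toLinearIsometryEquiv rfl
  have h1 : MeasurePreserving (WithLp.toLp 2 : (k → ℝ) → EuclideanSpace ℝ k)
      (Measure.pi fun _ => gaussianReal 0 1) (stdGaussian (EuclideanSpace ℝ k)) :=
    ⟨by fun_prop, map_pi_eq_stdGaussian⟩
  have h2 : MeasurePreserving e (stdGaussian (EuclideanSpace ℝ k))
      (stdGaussian (EuclideanSpace ℝ k)) := ⟨e.continuous.measurable, stdGaussian_map e⟩
  exact measurePreserving_ofLp_stdGaussian.comp (h2.comp h1)

theorem measurePreserving_mul_orthogonal [DecidableEq k] {R : Matrix k k ℝ} (hR : Rᵀ * R = 1) :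
    MeasurePreserving (fun (M : m → k → ℝ) i => R *ᵥ M i)
      (gaussianMatrix m k) (gaussianMatrix m k) :=
  measurePreserving_pi _ _ fun _ => measurePreserving_orthogonal_mulVec hR

theorem lintegral_transpose (f : (k → m → ℝ) → ℝ≥0∞) (hf : Measurable f) :
    ∫⁻ M, f (fun j i => M i j) ∂(gaussianMatrix m k) = ∫⁻ M, f M ∂(gaussianMatrix k m) :=
  (measurePreserving_transpose m k).lintegral_comp hf

/-- Integration over a Gaussian matrix, resampling the `i`-th row. -/
theorem lintegral_update_row [DecidableEq m] (i : m) (f : (m → k → ℝ) → ℝ≥0∞)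
    (hf : Measurable f) :
    ∫⁻ M, f M ∂(gaussianMatrix m k) = ∫⁻ M, ∫⁻ r, f (Function.update M i r)
      ∂(Measure.pi fun _ => gaussianReal 0 1) ∂(gaussianMatrix m k) := by
  set μ : m → Measure (k → ℝ) := fun _ => Measure.pi fun _ => gaussianReal 0 1 with hμ
  set g : (m → k → ℝ) → ℝ≥0∞ := fun M => ∫⁻ r, f (Function.update M i r) ∂(μ i) with hg
  have hg' : g = ∫⋯∫⁻_{i}, f ∂μ := (lmarginal_singleton f i).symm
  have hgm : Measurable g := hg' ▸ hf.lmarginal μ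
  change ∫⁻ M, f M ∂(Measure.pi μ) = ∫⁻ M, g M ∂(Measure.pi μ)
  -- The average `g` no longer depends on row `i`, so averaging it over that row again changes
  -- nothing.
  refine lintegral_eq_of_lmarginal_eq {i} hf hgm ?_
  rw [lmarginal_singleton g, ← hg']
  funext M
  simp [hg]

end GaussianMatrix

/-! ### Rotation-invariant quadratic functions -/

section Isotropy

variable {k : Type*} [Fintype k] [DecidableEq k]

/-- The Householder reflection along `e_i - u` exchanges these two unit vectors; the identity serves
when they coincide. -/
theorem exists_orthogonal_mulVec_single (u : k → ℝ) (hu : u ⬝ᵥ u = 1) (i : k) :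
    ∃ R : Matrix k k ℝ, Rᵀ * R = 1 ∧ R *ᵥ Pi.single i 1 = u := by
  set w : k → ℝ := Pi.single i 1 - u with hw
  by_cases h : w = 0
  · exact ⟨1, by simp, by rw [Matrix.one_mulVec]; exact sub_eq_zero.mp h⟩
  have hww : w ⬝ᵥ w ≠ 0 := fun h0 => h (dotProduct_self_eq_zero.mp h0)
  have hws : w ⬝ᵥ Pi.single i 1 = (w ⬝ᵥ w) / 2 := by
    simp only [hw, sub_dotProduct, dotProduct_sub, hu, dotProduct_comm u]
    simp
    ring
  refine ⟨1 - (2 / (w ⬝ᵥ w)) • Matrix.vecMulVec w w, ?_, ?_⟩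
  · have h2 : Matrix.vecMulVec w w * Matrix.vecMulVec w w = (w ⬝ᵥ w) • Matrix.vecMulVec w w := by
      rw [Matrix.vecMulVec_mul_vecMulVec, Matrix.vecMulVec_smul]
    simp only [Matrix.transpose_sub, Matrix.transpose_one, Matrix.transpose_smul,
      Matrix.transpose_vecMulVec, Matrix.mul_sub, Matrix.sub_mul, Matrix.one_mul, Matrix.mul_one,
      Matrix.smul_mul, Matrix.mul_smul, h2, smul_smul, smul_sub]
    have : 2 / (w ⬝ᵥ w) * (2 / (w ⬝ᵥ w) * (w ⬝ᵥ w)) = 2 / (w ⬝ᵥ w) + 2 / (w ⬝ᵥ w) := by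
      field_simp; norm_num
    rw [this, add_smul]
    abel
  · rw [Matrix.sub_mulVec, Matrix.one_mulVec, Matrix.smul_mulVec, Matrix.vecMulVec_mulVec, hws]
    have h2 : 2 / (w ⬝ᵥ w) * ((w ⬝ᵥ w) / 2) = 1 := by field_simp
    ext j
    simp only [Pi.sub_apply, Pi.smul_apply, MulOpposite.smul_eq_mul_unop, MulOpposite.unop_op,
      smul_eq_mul]
    have hwj : w j = (Pi.single i 1 : k → ℝ) j - u j := rfl
    linear_combination (-w j) * h2 - hwj

/-- A rotation invariant function on `ℝᵏ` that is homogeneous of degree two is a multiple of the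
squared norm. -/
theorem card_mul_eq_of_isotropic (F : (k → ℝ) → ℝ≥0∞)
    (hrot : ∀ (R : Matrix k k ℝ), Rᵀ * R = 1 → ∀ x, F (R *ᵥ x) = F x)
    (hhom : ∀ (c : ℝ) x, F (c • x) = ENNReal.ofReal (c ^ 2) * F x) (x : k → ℝ) :
    (Fintype.card k : ℝ≥0∞) * F x = ENNReal.ofReal (x ⬝ᵥ x) * ∑ i, F (Pi.single i 1) := by
  have h : ∀ i, F x = ENNReal.ofReal (x ⬝ᵥ x) * F (Pi.single i 1) := by
    intro i
    have hnn : 0 ≤ x ⬝ᵥ x := Finset.sum_nonneg fun i _ => mul_self_nonneg _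
    by_cases hx : x ⬝ᵥ x = 0
    -- Homogeneity with factor `0` forces `F 0 = 0`, since `0 * ∞ = 0`.
    · rw [hx, dotProduct_self_eq_zero.mp hx]
      simpa using hhom 0 0
    set c := √(x ⬝ᵥ x) with hc
    have hc2 : c ^ 2 = x ⬝ᵥ x := Real.sq_sqrt hnn
    have hc0 : c ≠ 0 := fun h0 => hx (by rw [← hc2, h0]; simp)
    obtain ⟨R, hR, hRi⟩ := exists_orthogonal_mulVec_single (c⁻¹ • x) (by
      rw [smul_dotProduct, dotProduct_smul, ← hc2, smul_eq_mul, smul_eq_mul]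
      field_simp) i
    rw [← hrot R hR (Pi.single i 1), hRi, ← hc2, ← hhom, smul_smul, mul_inv_cancel₀ hc0, one_smul]
  rw [Finset.mul_sum, ← Finset.sum_congr rfl fun i _ => h i]
  simp

end Isotropy

/-! ### Mean of an inverse chi-square variable by Laplace transform -/

section InverseChiSquare

theorem integral_exp_neg_mul_sq_gaussianReal {t : ℝ} (ht : 0 ≤ t) :
    ∫ x, Real.exp (-t * x ^ 2) ∂(gaussianReal 0 1) = (1 + 2 * t) ^ (-(1 / 2) : ℝ) := by
  rw [integral_gaussianReal_eq_integral_smul one_ne_zero]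
  have h : ∀ x : ℝ, gaussianPDFReal 0 1 x • Real.exp (-t * x ^ 2)
      = (√(2 * Real.pi))⁻¹ * Real.exp (-(1 / 2 + t) * x ^ 2) := by
    intro x
    rw [gaussianPDFReal_def, smul_eq_mul, mul_assoc, ← Real.exp_add]
    congr 2
    · simp
    · push_cast; ring
  simp_rw [h]
  rw [integral_const_mul, integral_gaussian, ← Real.sqrt_inv, ← Real.sqrt_mul (by positivity),
    Real.rpow_neg (by positivity), ← Real.sqrt_eq_rpow, ← Real.sqrt_inv]
  congr 1
  have := Real.pi_pos
  field_simp

theorem lintegral_exp_neg_mul_sum_sq {ι : Type*} [Fintype ι] {t : ℝ} (ht : 0 ≤ t) :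
    ∫⁻ x : ι → ℝ, ENNReal.ofReal (Real.exp (-t * ∑ i, x i ^ 2))
      ∂(Measure.pi fun _ => gaussianReal 0 1) =
      ENNReal.ofReal ((1 + 2 * t) ^ (-(Fintype.card ι : ℝ) / 2)) := by
  rw [← ofReal_integral_eq_lintegral_ofReal]
  · congr 1
    simp_rw [Finset.mul_sum, Real.exp_sum]
    rw [integral_fintype_prod_eq_prod (f := fun _ x => Real.exp (-t * x ^ 2))]
    simp_rw [integral_exp_neg_mul_sq_gaussianReal ht]
    rw [Finset.prod_const, Finset.card_univ, ← Real.rpow_natCast, ← Real.rpow_mul (by positivity)]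
    congr 1
    ring
  · refine Integrable.of_bound (C := 1)
      (Measurable.aestronglyMeasurable (by fun_prop)) (Filter.Eventually.of_forall fun x => ?_)
    rw [Real.norm_eq_abs, abs_of_pos (Real.exp_pos _), Real.exp_le_one_iff]
    have : 0 ≤ ∑ i, x i ^ 2 := Finset.sum_nonneg fun i _ => sq_nonneg _
    nlinarith
  · exact Filter.Eventually.of_forall fun x => (Real.exp_pos _).le

/-- The orthogonal projection of a standard Gaussian vector is standard Gaussian. -/
theorem stdGaussian_map_orthogonalProjectionOnto {E : Type*} [NormedAddCommGroup E]
    [InnerProductSpace ℝ E] [FiniteDimensional ℝ E] [MeasurableSpace E] [BorelSpace E]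
    (V : Submodule ℝ E) : (stdGaussian E).map V.orthogonalProjectionOnto = stdGaussian V := by
  apply Measure.ext_of_charFunDual
  ext L
  rw [charFunDual_map, charFunDual_stdGaussian, charFunDual_stdGaussian]
  -- The characteristic function of a standard Gaussian sees a functional only through its norm, and
  -- the projection preserves that norm since it is the identity on `V`.
  have : ‖L.comp V.orthogonalProjectionOnto‖ = ‖L‖ := by
    apply le_antisymm
    · refine (L.opNorm_comp_le _).trans ?_
      exact mul_le_of_le_one_right (norm_nonneg _) V.orthogonalProjectionOnto_norm_le
    · refine ContinuousLinearMap.opNorm_le_bound _ (norm_nonneg _) fun x => ?_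
      have := (L.comp V.orthogonalProjectionOnto).le_opNorm (x : E)
      simpa using this
  rw [this]

theorem lintegral_exp_neg_mul_norm_sq_stdGaussian {E : Type*} [NormedAddCommGroup E]
    [InnerProductSpace ℝ E] [FiniteDimensional ℝ E] [MeasurableSpace E] [BorelSpace E]
    {t : ℝ} (ht : 0 ≤ t) :
    ∫⁻ x, ENNReal.ofReal (Real.exp (-t * ‖x‖ ^ 2)) ∂(stdGaussian E) =
      ENNReal.ofReal ((1 + 2 * t) ^ (-(Module.finrank ℝ E : ℝ) / 2)) := by
  set e := (stdOrthonormalBasis ℝ E).repr.symm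
  rw [← stdGaussian_map e, lintegral_map (by fun_prop) (by fun_prop), ← map_pi_eq_stdGaussian,
    lintegral_map (by fun_prop) (by fun_prop)]
  simp_rw [LinearIsometryEquiv.norm_map, EuclideanSpace.real_norm_sq_eq]
  rw [lintegral_exp_neg_mul_sum_sq ht, Fintype.card_fin]

theorem lintegral_exp_neg_mul_norm_sq_starProjection {k : Type*} [Fintype k]
    (V : Submodule ℝ (EuclideanSpace ℝ k)) {t : ℝ} (ht : 0 ≤ t) :
    ∫⁻ r : k → ℝ, ENNReal.ofReal (Real.exp (-t * ‖V.starProjection (WithLp.toLp 2 r)‖ ^ 2))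
      ∂(Measure.pi fun _ => gaussianReal 0 1) =
      ENNReal.ofReal ((1 + 2 * t) ^ (-(Module.finrank ℝ V : ℝ) / 2)) := by
  rw [← lintegral_exp_neg_mul_norm_sq_stdGaussian ht, ← stdGaussian_map_orthogonalProjectionOnto,
    lintegral_map (by fun_prop) (by fun_prop), ← map_pi_eq_stdGaussian,
    lintegral_map (by fun_prop) (by fun_prop)]
  rfl

theorem ofReal_inv_eq_lintegral_exp {s : ℝ} (hs : 0 < s) :
    ENNReal.ofReal s⁻¹ = ∫⁻ t in Set.Ioi (0 : ℝ), ENNReal.ofReal (Real.exp (-t * s)) := by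
  have h : ∀ t : ℝ, -t * s = -s * t := fun t => by ring
  simp_rw [h]
  rw [← ofReal_integral_eq_lintegral_ofReal]
  · rw [integral_exp_mul_Ioi (by linarith)]
    simp
  · exact integrableOn_exp_mul_Ioi (by linarith) _
  · exact Filter.Eventually.of_forall fun x => (Real.exp_pos _).le

/-- The integrand is the Laplace transform of a chi-square variable with `d` degrees of freedom, so
by `1/s = ∫ exp (-t s) dt` this is its mean inverse. A primitive is explicit for `d > 2`; for `d ≤
2` the integrand dominates `1 / (3 t)` on `t > 1`. -/
theorem lintegral_one_add_two_mul_rpow (d : ℕ) :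
    ∫⁻ t in Set.Ioi (0 : ℝ), ENNReal.ofReal ((1 + 2 * t) ^ (-(d : ℝ) / 2)) =
      if 2 < d then ENNReal.ofReal (1 / ((d : ℝ) - 2)) else ∞ := by
  split_ifs with hd
  · have hd' : (2 : ℝ) < d := by exact_mod_cast hd
    have hder : ∀ x ∈ Set.Ici (0 : ℝ), HasDerivAt
        (fun t : ℝ => -(1 + 2 * t) ^ (-(d : ℝ) / 2 + 1) / ((d : ℝ) - 2))
        ((1 + 2 * x) ^ (-(d : ℝ) / 2)) x := by
      intro x hx
      have hx' : (0 : ℝ) ≤ x := hx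
      have h1 : HasDerivAt (fun t : ℝ => 1 + 2 * t) 2 x := by
        simpa using ((hasDerivAt_id x).const_mul 2).const_add 1
      have h2 := ((h1.rpow_const (p := -(d : ℝ) / 2 + 1) (Or.inl (by positivity))).neg).div_const
        ((d : ℝ) - 2)
      refine h2.congr_deriv ?_
      have : (d : ℝ) - 2 ≠ 0 := by linarith
      rw [add_sub_cancel_right]
      field_simp
      ring
    have hlim : Filter.Tendsto (fun t : ℝ => -(1 + 2 * t) ^ (-(d : ℝ) / 2 + 1) / ((d : ℝ) - 2))
        Filter.atTop (nhds 0) := by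
      have h1 : Filter.Tendsto (fun t : ℝ => 1 + 2 * t) Filter.atTop Filter.atTop :=
        Filter.tendsto_atTop_add_const_left _ _ (Filter.tendsto_id.const_mul_atTop two_pos)
      have h2 := (tendsto_rpow_neg_atTop (y := (d : ℝ) / 2 - 1) (by linarith)).comp h1
      have h3 := (h2.neg).div_const ((d : ℝ) - 2)
      simp only [neg_zero, zero_div] at h3
      refine h3.congr fun t => ?_
      simp only [Function.comp]
      congr 3
      ring
    have hnn : ∀ x ∈ Set.Ioi (0 : ℝ), 0 ≤ (1 + 2 * x) ^ (-(d : ℝ) / 2) := by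
      intro x hx
      have hx' : (0 : ℝ) < x := hx
      positivity
    rw [← ofReal_integral_eq_lintegral_ofReal]
    · rw [integral_Ioi_of_hasDerivAt_of_nonneg' hder hnn hlim]
      congr 1
      simp [neg_div]
    · exact integrableOn_Ioi_deriv_of_nonneg' hder hnn hlim
    · exact (ae_restrict_iff' measurableSet_Ioi).mpr (Filter.Eventually.of_forall hnn)
  · have hd' : (d : ℝ) ≤ 2 := by exact_mod_cast not_lt.mp hd
    by_contra hfin
    have hfin' := lt_top_iff_ne_top.mpr hfin
    have h1 : ∫⁻ t in Set.Ioi (1 : ℝ), ENNReal.ofReal (3⁻¹ * t ^ (-1 : ℝ)) < ∞ := by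
      refine lt_of_le_of_lt ?_ hfin'
      refine (setLIntegral_mono' measurableSet_Ioi fun t ht => ?_).trans
        (lintegral_mono_set (Set.Ioi_subset_Ioi zero_le_one))
      have ht' : (1 : ℝ) < t := ht
      apply ENNReal.ofReal_le_ofReal
      calc 3⁻¹ * t ^ (-1 : ℝ) = (3 * t)⁻¹ := by rw [Real.rpow_neg_one, mul_inv]
        _ ≤ (1 + 2 * t)⁻¹ := inv_anti₀ (by linarith) (by linarith)
        _ = (1 + 2 * t) ^ (-1 : ℝ) := (Real.rpow_neg_one _).symm
        _ ≤ _ := Real.rpow_le_rpow_of_exponent_le (by linarith) (by linarith)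
    have h2 : IntegrableOn (fun t : ℝ => 3⁻¹ * t ^ (-1 : ℝ)) (Set.Ioi 1) := by
      refine ⟨by fun_prop, ?_⟩
      rw [hasFiniteIntegral_iff_ofReal]
      · exact h1
      · refine (ae_restrict_iff' measurableSet_Ioi).mpr (Filter.Eventually.of_forall fun t ht => ?_)
        have ht' : (1 : ℝ) < t := ht
        positivity
    have h3 : IntegrableOn (fun t : ℝ => t ^ (-1 : ℝ)) (Set.Ioi 1) := by
      have := h2.const_mul 3
      simp only [← mul_assoc, mul_inv_cancel₀ (three_ne_zero' ℝ), one_mul] at this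
      exact this
    rw [integrableOn_Ioi_rpow_iff one_pos] at h3
    exact lt_irrefl _ h3

/-- Expectation of the inverse of a chi-square variable with `finrank V` degrees of freedom. -/
theorem lintegral_inv_norm_sq_starProjection {k : Type*} [Fintype k]
    (V : Submodule ℝ (EuclideanSpace ℝ k)) (f : (k → ℝ) → ℝ)
    (hf : ∀ᵐ r ∂(Measure.pi fun _ => gaussianReal 0 1),
      f r * ‖V.starProjection (WithLp.toLp 2 r)‖ ^ 2 = 1) :
    ∫⁻ r : k → ℝ, ENNReal.ofReal (f r) ∂(Measure.pi fun _ => gaussianReal 0 1) =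
      if 2 < Module.finrank ℝ V then ENNReal.ofReal (1 / ((Module.finrank ℝ V : ℝ) - 2))
      else ∞ := by
  rw [← lintegral_one_add_two_mul_rpow]
  calc ∫⁻ r : k → ℝ, ENNReal.ofReal (f r) ∂(Measure.pi fun _ => gaussianReal 0 1)
      = ∫⁻ r : k → ℝ, ∫⁻ t in Set.Ioi (0 : ℝ), ENNReal.ofReal
          (Real.exp (-t * ‖V.starProjection (WithLp.toLp 2 r)‖ ^ 2)) ∂volume
          ∂(Measure.pi fun _ => gaussianReal 0 1) := by
        refine lintegral_congr_ae (hf.mono fun r hr => ?_)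
        have h0 : ‖V.starProjection (WithLp.toLp 2 r)‖ ^ 2 ≠ 0 := right_ne_zero_of_mul_eq_one hr
        change ENNReal.ofReal (f r) = _
        rw [eq_inv_of_mul_eq_one_left hr]
        exact ofReal_inv_eq_lintegral_exp (lt_of_le_of_ne (sq_nonneg _) h0.symm)
    _ = ∫⁻ t in Set.Ioi (0 : ℝ), ∫⁻ r : k → ℝ, ENNReal.ofReal
          (Real.exp (-t * ‖V.starProjection (WithLp.toLp 2 r)‖ ^ 2))
          ∂(Measure.pi fun _ => gaussianReal 0 1) := by
        apply lintegral_lintegral_swap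
        apply Measurable.aemeasurable
        unfold Function.uncurry
        fun_prop
    _ = _ := by
        refine setLIntegral_congr_fun measurableSet_Ioi fun t ht => ?_
        exact lintegral_exp_neg_mul_norm_sq_starProjection V (le_of_lt ht)

end InverseChiSquare

/-! ### Almost sure full rank -/

section FullRank

variable {m k : Type*} [Fintype m] [Fintype k]

/-- A proper subspace is a null set for the standard Gaussian measure. -/
theorem ae_notMem_of_finrank_lt (U : Submodule ℝ (EuclideanSpace ℝ k))
    (hU : Module.finrank ℝ U < Fintype.card k) :
    ∀ᵐ r : k → ℝ ∂(Measure.pi fun _ => gaussianReal 0 1), WithLp.toLp 2 r ∉ U := by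
  have hU' : U ≠ ⊤ := by
    rintro rfl
    simp at hU
  have hV : Uᗮ ≠ ⊥ := fun h => hU' (Submodule.orthogonal_eq_bot_iff.mp h)
  -- Pairing with a nonzero normal vector `u` gives a nondegenerate real Gaussian, which has no atom
  -- at `0`.
  obtain ⟨u, hu, hu0⟩ := Submodule.exists_mem_ne_zero_of_ne_bot hV
  set L : StrongDual ℝ (EuclideanSpace ℝ k) := innerSL ℝ u with hL
  have hLG : (stdGaussian (EuclideanSpace ℝ k)).map L
      = gaussianReal 0 (‖u‖ ^ 2).toNNReal := by
    rw [IsGaussian.map_eq_gaussianReal, integral_strongDual_stdGaussian, variance_dual_stdGaussian,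
      hL, innerSL_apply_norm]
  have := nullSingletonClass_gaussianReal (μ := 0) (v := (‖u‖ ^ 2).toNNReal) (by simpa using hu0)
  have h1 : ∀ᵐ y ∂(stdGaussian (EuclideanSpace ℝ k)).map L, y ≠ 0 := by
    rw [hLG]
    exact compl_mem_ae_iff.mpr (measure_singleton (0 : ℝ))
  have h2 := ae_of_ae_map L.continuous.aemeasurable h1
  rw [← map_pi_eq_stdGaussian] at h2
  have h3 := ae_of_ae_map (by fun_prop) h2
  refine h3.mono fun r hr hrU => hr ?_
  exact Submodule.inner_left_of_mem_orthogonal hrU hu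

end FullRank

section FullRankAE

variable {m k : Type*} [Fintype m] [Fintype k] [DecidableEq m]

/-- This form transfers almost sure properties: what holds for almost every matrix still holds, for
almost every `M`, after resampling row `i` at almost every value. -/
theorem measurePreserving_update_row (i : m) :
    MeasurePreserving (fun q : (m → k → ℝ) × (k → ℝ) => Function.update q.1 i q.2)
      ((gaussianMatrix m k).prod (Measure.pi fun _ => gaussianReal 0 1)) (gaussianMatrix m k) := by
  have hm : Measurable fun q : (m → k → ℝ) × (k → ℝ) => Function.update q.1 i q.2 := by
    refine measurable_pi_lambda _ fun j => ?_
    by_cases h : j = i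
    · subst h; simpa using measurable_snd
    · simp only [Function.update_of_ne h]; fun_prop
  refine ⟨hm, Measure.ext fun s hs => ?_⟩
  rw [← lintegral_indicator_one hs, ← lintegral_indicator_one hs,
    lintegral_map (measurable_one.indicator hs) hm,
    lintegral_update_row i _ (measurable_one.indicator hs), lintegral_prod]
  exact ((measurable_one.indicator hs).comp hm).aemeasurable

/-- Membership in the span of the other rows, through the projection onto the row space. -/
theorem mem_otherRows_iff (M : m → k → ℝ) (i : m) (v : k → ℝ) :
    WithLp.toLp 2 v ∈ otherRows M i ↔
      v ᵥ* (pinv (Matrix.of (Function.update M i 0)) * Matrix.of (Function.update M i 0)) = v := by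
  -- Zeroing row `i` leaves the span of the others, so `N⁺N` projects onto that span.
  set N := Matrix.of (Function.update M i 0) with hN
  constructor
  · intro h
    unfold otherRows at h
    suffices H : ∀ y ∈ Submodule.span ℝ (rowVec M '' (Set.univ \ {i})),
        y.ofLp ᵥ* (pinv N * N) = y.ofLp from H _ h
    intro y hy
    induction hy using Submodule.span_induction with
    | mem y hy =>
      obtain ⟨j, hj, rfl⟩ := hy
      have hj : j ≠ i := by simpa using hj
      have h1 : (rowVec M j).ofLp = N j := by
        exact (Function.update_of_ne hj 0 M).symm
      have h2 := congrFun (pinv_spec N).mul_mul_left j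
      rw [Matrix.mul_assoc, Matrix.mul_apply_eq_vecMul] at h2
      rw [h1]
      exact h2
    | zero => simp
    | add y z _ _ hy hz => rw [WithLp.ofLp_add, Matrix.add_vecMul, hy, hz]
    | smul a y _ hy => rw [WithLp.ofLp_smul, Matrix.smul_vecMul, hy]
  · intro h
    rw [← Matrix.vecMul_vecMul] at h
    set c := v ᵥ* pinv N with hc
    have hv : WithLp.toLp 2 v = ∑ j, c j • (WithLp.toLp 2 (N j) : EuclideanSpace ℝ k) := by
      ext l
      rw [← h]
      simp [Matrix.vecMul, dotProduct]
    rw [hv]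
    refine Submodule.sum_mem _ fun j _ => Submodule.smul_mem _ _ ?_
    by_cases hj : j = i
    · have : N j = 0 := by rw [hN, hj]; funext l; simp
      rw [this]
      exact Submodule.zero_mem _
    · refine Submodule.subset_span ⟨j, by simpa using hj, ?_⟩
      exact congrArg (WithLp.toLp 2) (Function.update_of_ne hj 0 M).symm

theorem ae_rowVec_notMem_otherRows (h : Fintype.card m ≤ Fintype.card k) (i : m) :
    ∀ᵐ M ∂(gaussianMatrix m k), rowVec M i ∉ otherRows M i := by
  -- Membership in a span that varies with `M` becomes an equation between measurable functions, so
  -- the resampling formula applies to the event.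
  set s : Set (m → k → ℝ) := {M | M i ᵥ* (pinv (Matrix.of (Function.update M i 0)) *
    Matrix.of (Function.update M i 0)) = M i} with hs
  have hsm : MeasurableSet s := by
    refine measurableSet_eq_fun (measurable_pi_lambda _ fun l => ?_) (measurable_pi_apply i)
    have hu : Measurable fun M : m → k → ℝ => Function.update M i (0 : k → ℝ) :=
      measurable_update_left
    have hp : ∀ l j, Measurable fun M : m → k → ℝ => pinv (Matrix.of (Function.update M i 0)) l j :=
      fun l j => (measurable_pinv_apply l j).comp hu
    simp only [Matrix.vecMul, dotProduct, Matrix.mul_apply, Matrix.of_apply]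
    fun_prop
  have h0 : gaussianMatrix m k s = 0 := by
    rw [← lintegral_indicator_one hsm, lintegral_update_row i _ (measurable_one.indicator hsm)]
    refine (lintegral_congr fun M => ?_).trans lintegral_zero
    rw [← lintegral_zero (μ := Measure.pi fun _ : k => gaussianReal 0 1)]
    refine lintegral_congr_ae ?_
    refine (ae_notMem_of_finrank_lt (otherRows M i)
      ((finrank_otherRows_lt M i).trans_le h)).mono fun r hr => ?_
    refine Set.indicator_of_notMem (fun hmem => hr ?_) _
    rw [mem_otherRows_iff]
    simpa [hs] using hmem
  refine (measure_eq_zero_iff_ae_notMem.mp h0).mono fun M hM hmem => hM ?_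
  exact (mem_otherRows_iff M i (M i)).mp hmem

/-- A Gaussian matrix with at most as many rows as columns almost surely has full rank. -/
theorem ae_linearIndependent_rowVec (h : Fintype.card m ≤ Fintype.card k) :
    ∀ᵐ M ∂(gaussianMatrix m k), LinearIndependent ℝ (rowVec M) := by
  refine (ae_all_iff.mpr fun i => ae_rowVec_notMem_otherRows h i).mono fun M hM => ?_
  exact linearIndependent_iff_notMem_span.mpr hM

end FullRankAE

/-! ### Expected Frobenius norm of the Gaussian pseudoinverse -/

section Energy

variable (m k : Type*) [Fintype m] [Fintype k]

/-- The expected squared Frobenius norm of the pseudoinverse of a Gaussian matrix. -/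
noncomputable def pinvEnergy : ℝ≥0∞ :=
  ∫⁻ M, ENNReal.ofReal (∑ i, ∑ l, pinv (Matrix.of M) l i ^ 2) ∂(gaussianMatrix m k)

theorem pinvEnergy_comm : pinvEnergy m k = pinvEnergy k m := by
  unfold pinvEnergy
  have hm := fun l i => measurable_pinv_apply (m := k) (k := m) l i
  rw [← lintegral_transpose (m := m) (k := k) _ (by fun_prop)]
  refine lintegral_congr fun M => ?_
  have : (Matrix.of fun j i => M i j) = (Matrix.of M)ᵀ := rfl
  rw [this, pinv_transpose, Finset.sum_comm]
  rfl

theorem pinvEnergy_of_card_le (h : Fintype.card m ≤ Fintype.card k) :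
    pinvEnergy m k = Fintype.card m *
      if Fintype.card m + 1 < Fintype.card k then
        ENNReal.ofReal (1 / ((Fintype.card k : ℝ) - Fintype.card m - 1)) else ∞ := by
  classical
  have hm := fun l i => measurable_pinv_apply (m := m) (k := k) l i
  unfold pinvEnergy
  simp_rw [ENNReal.ofReal_sum_of_nonneg
    (fun i _ => Finset.sum_nonneg fun l _ => sq_nonneg (pinv (Matrix.of _) l i))]
  rw [lintegral_finsetSum _ (fun i _ => by fun_prop)]
  have key : ∀ i : m, ∫⁻ M, ENNReal.ofReal (∑ l, pinv (Matrix.of M) l i ^ 2)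
      ∂(gaussianMatrix m k) = if Fintype.card m + 1 < Fintype.card k then
        ENNReal.ofReal (1 / ((Fintype.card k : ℝ) - Fintype.card m - 1)) else ∞ := by
    intro i
    rw [lintegral_update_row i _ (by fun_prop)]
    have hLI := ae_linearIndependent_rowVec (m := m) (k := k) h
    have hLI' := Measure.ae_ae_of_ae_prod
      ((measurePreserving_update_row (m := m) (k := k) i).quasiMeasurePreserving.ae hLI)
    have hc : ∀ᵐ M ∂(gaussianMatrix m k), ∫⁻ r, ENNReal.ofReal
        (∑ l, pinv (Matrix.of (Function.update M i r)) l i ^ 2)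
          ∂(Measure.pi fun _ => gaussianReal 0 1) =
        if Fintype.card m + 1 < Fintype.card k then
        ENNReal.ofReal (1 / ((Fintype.card k : ℝ) - Fintype.card m - 1)) else ∞ := by
      filter_upwards [hLI, hLI'] with M hM hM'
      rw [lintegral_inv_norm_sq_starProjection (otherRows M i)ᗮ]
      · have h1 := finrank_otherRows hM i
        have h2 := (otherRows M i).finrank_add_finrank_orthogonal
        rw [finrank_euclideanSpace] at h2
        have h3 : Module.finrank ℝ (otherRows M i)ᗮ + Fintype.card m = Fintype.card k + 1 := by
          omega
        -- There are `k - m + 1` degrees of freedom: the span omits row `i` and has dimension `m -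
        -- 1`.
        have h4 : (Module.finrank ℝ (otherRows M i)ᗮ : ℝ) - 2
            = (Fintype.card k : ℝ) - Fintype.card m - 1 := by
          have : (Module.finrank ℝ (otherRows M i)ᗮ : ℝ) + Fintype.card m = Fintype.card k + 1 := by
            exact_mod_cast h3
          linarith
        rw [h4]
        refine if_congr ?_ rfl rfl
        omega
      · refine hM'.mono fun r hr => ?_
        have := sum_sq_pinv_col hr i
        rw [otherRows_update] at this
        simpa [rowVec] using this
    rw [lintegral_congr_ae hc, lintegral_const, measure_univ, mul_one]
  rw [Finset.sum_congr rfl fun i _ => key i, Finset.sum_const, Finset.card_univ, nsmul_eq_mul]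

theorem pinvEnergy_eq_gam (hm : 0 < Fintype.card m) (hk : 0 < Fintype.card k) :
    pinvEnergy m k = gam (Fintype.card k) (Fintype.card m) := by
  have hmul : ∀ (a : ℕ) (b : ℝ), (a : ℝ≥0∞) * ENNReal.ofReal (1 / b) = ENNReal.ofReal (a / b) := by
    intro a b
    rw [← ENNReal.ofReal_natCast, ← ENNReal.ofReal_mul (Nat.cast_nonneg _), mul_one_div]
  unfold gam
  rcases le_total (Fintype.card m) (Fintype.card k) with h | h
  · rw [pinvEnergy_of_card_le m k h,
      if_neg (show ¬ Fintype.card k + 1 < Fintype.card m by omega)]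
    split_ifs with h1
    · exact hmul _ _
    -- Positivity matters: with no rows the product would be `0 * ∞ = 0`.
    · exact ENNReal.mul_top (by exact_mod_cast hm.ne')
  · rw [pinvEnergy_comm, pinvEnergy_of_card_le k m h]
    split_ifs with h1 h2
    · exact hmul _ _
    · omega
    · exact ENNReal.mul_top (by exact_mod_cast hk.ne')

end Energy

/-! ### Averages over a Gaussian matrix for a fixed vector -/

section Averages

variable {m k : Type*} [Fintype m] [Fintype k]

theorem measurePreserving_orthogonal_mul [DecidableEq m] {Q : Matrix m m ℝ} (hQ : Qᵀ * Q = 1) :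
    MeasurePreserving (fun (M : m → k → ℝ) i j => (Q * Matrix.of M) i j)
      (gaussianMatrix m k) (gaussianMatrix m k) :=
  (measurePreserving_transpose k m).comp
    ((measurePreserving_mul_orthogonal (m := k) hQ).comp (measurePreserving_transpose m k))

/-- The mean of `‖M⁺ u‖²` for a Gaussian matrix `M` and a fixed vector `u`. -/
theorem card_mul_lintegral_pinv_mulVec (u : m → ℝ) :
    (Fintype.card m : ℝ≥0∞) * ∫⁻ M, ENNReal.ofReal (∑ l, (pinv (Matrix.of M) *ᵥ u) l ^ 2)
      ∂(gaussianMatrix m k) = ENNReal.ofReal (u ⬝ᵥ u) * pinvEnergy m k := by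
  classical
  have hm := fun l i => measurable_pinv_apply (m := m) (k := k) l i
  have hme : ∀ u : m → ℝ, Measurable fun M : m → k → ℝ =>
      ENNReal.ofReal (∑ l, (pinv (Matrix.of M) *ᵥ u) l ^ 2) := by
    intro u
    simp only [Matrix.mulVec, dotProduct]
    fun_prop
  rw [card_mul_eq_of_isotropic (fun u => ∫⁻ M, ENNReal.ofReal (∑ l, (pinv (Matrix.of M) *ᵥ u) l ^ 2)
      ∂(gaussianMatrix m k))]
  · congr 1
    rw [← lintegral_finsetSum _ (fun i _ => hme _)]
    refine lintegral_congr fun M => ?_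
    rw [ENNReal.ofReal_sum_of_nonneg fun i _ => Finset.sum_nonneg fun l _ => sq_nonneg _]
    simp
  -- `M` and `RᵀM` have the same law, and `(RᵀM)⁺ = M⁺R`.
  · intro R hR x
    have hR' : Rᵀᵀ * Rᵀ = 1 := by rw [Matrix.transpose_transpose]; exact mul_eq_one_comm.mp hR
    rw [← (measurePreserving_orthogonal_mul (k := k) hR').lintegral_comp (hme x)]
    refine lintegral_congr fun M => ?_
    have : (Matrix.of fun i j => (Rᵀ * Matrix.of M) i j) = Rᵀ * Matrix.of M := rfl
    rw [this, pinv_orthogonal_mul _ hR', Matrix.transpose_transpose, Matrix.mulVec_mulVec]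
  · intro c x
    rw [← lintegral_const_mul _ (hme x)]
    refine lintegral_congr fun M => ?_
    rw [← ENNReal.ofReal_mul (sq_nonneg c), Finset.mul_sum]
    simp [Matrix.mulVec_smul, mul_pow]

/-- `M⁺M` is the orthogonal projection onto the row space, so its trace is the rank, almost surely
full. A tall matrix is handled through its transpose. -/
theorem ae_trace_pinv_mul :
    ∀ᵐ M ∂(gaussianMatrix m k), (pinv (Matrix.of M) * Matrix.of M).trace =
      ((min (Fintype.card m) (Fintype.card k) : ℕ) : ℝ) := by
  classical
  rcases le_total (Fintype.card m) (Fintype.card k) with h | h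
  · refine (ae_linearIndependent_rowVec h).mono fun M hM => ?_
    rw [Matrix.trace_mul_comm,
      mul_pinv_of_linearIndependent ((linearIndependent_row_iff M).mpr hM), Matrix.trace_one,
      min_eq_left h]
  · refine ((measurePreserving_transpose m k).quasiMeasurePreserving.ae
      (ae_linearIndependent_rowVec h)).mono fun M hM => ?_
    have h1 := mul_pinv_of_linearIndependent ((linearIndependent_row_iff _).mpr hM)
    have h2 : (Matrix.of fun j i => M i j) = (Matrix.of M)ᵀ := rfl
    rw [h2, pinv_transpose, ← Matrix.transpose_mul] at h1
    rw [← Matrix.trace_transpose, h1, Matrix.trace_one, min_eq_right h]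

/-- The mean squared norm of the projection of a fixed vector onto the kernel of a Gaussian
matrix. -/
theorem card_mul_lintegral_sub_pinv_mul_mulVec (x : k → ℝ) :
    (Fintype.card k : ℝ≥0∞) * ∫⁻ M, ENNReal.ofReal
      (∑ l, (x - (pinv (Matrix.of M) * Matrix.of M) *ᵥ x) l ^ 2) ∂(gaussianMatrix m k) =
    ENNReal.ofReal (x ⬝ᵥ x) * ENNReal.ofReal
      ((Fintype.card k : ℝ) - (min (Fintype.card m) (Fintype.card k) : ℕ)) := by
  classical
  have hm := fun l i => measurable_pinv_apply (m := m) (k := k) l i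
  have hme : ∀ x : k → ℝ, Measurable fun M : m → k → ℝ =>
      ENNReal.ofReal (∑ l, (x - (pinv (Matrix.of M) * Matrix.of M) *ᵥ x) l ^ 2) := by
    intro x
    simp only [Matrix.mulVec, dotProduct, Pi.sub_apply, Matrix.mul_apply, Matrix.of_apply]
    fun_prop
  rw [card_mul_eq_of_isotropic (fun x => ∫⁻ M, ENNReal.ofReal
      (∑ l, (x - (pinv (Matrix.of M) * Matrix.of M) *ᵥ x) l ^ 2) ∂(gaussianMatrix m k))]
  · congr 1
    rw [← lintegral_finsetSum _ (fun i _ => hme _)]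
    have hc : ∀ᵐ M ∂(gaussianMatrix m k), ∑ i, ENNReal.ofReal (∑ l, ((Pi.single i 1 : k → ℝ) -
        (pinv (Matrix.of M) * Matrix.of M) *ᵥ Pi.single i 1) l ^ 2) = ENNReal.ofReal
          ((Fintype.card k : ℝ) - (min (Fintype.card m) (Fintype.card k) : ℕ)) := by
      refine ae_trace_pinv_mul.mono fun M hM => ?_
      rw [← ENNReal.ofReal_sum_of_nonneg fun i _ => Finset.sum_nonneg fun l _ => sq_nonneg _]
      congr 1
      set Pr := pinv (Matrix.of M) * Matrix.of M with hPr
      have hsymm : Prᵀ = Pr := (pinv_spec (Matrix.of M)).symm_right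
      have hidem : Pr * Pr = Pr := by
        rw [hPr, ← Matrix.mul_assoc, (pinv_spec (Matrix.of M)).mul_mul_right]
      -- For an orthogonal projection the sum of squared entries equals the trace.
      have h1 : (1 - Pr)ᵀ * (1 - Pr) = 1 - Pr := by
        rw [Matrix.transpose_sub, Matrix.transpose_one, hsymm, Matrix.sub_mul, Matrix.mul_sub,
          Matrix.mul_sub, hidem]
        simp
      have h2 := congrArg Matrix.trace h1
      rw [Matrix.trace_sub, Matrix.trace_one, hM] at h2
      rw [← h2, Matrix.trace]
      refine Finset.sum_congr rfl fun i _ => ?_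
      rw [Matrix.diag_apply, Matrix.mul_apply]
      refine Finset.sum_congr rfl fun l _ => ?_
      rw [sq, Matrix.transpose_apply, Matrix.sub_apply, Pi.sub_apply, Matrix.mulVec_single_one,
        Matrix.col_apply, Matrix.one_apply, Pi.single_apply]
    rw [lintegral_congr_ae hc, lintegral_const, measure_univ, mul_one]
  · intro R hR x
    have hR' : Rᵀᵀ * Rᵀ = 1 := by rw [Matrix.transpose_transpose]; exact mul_eq_one_comm.mp hR
    rw [← (measurePreserving_mul_orthogonal (m := m) hR).lintegral_comp (hme (R *ᵥ x))]
    refine lintegral_congr fun M => ?_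
    have : (Matrix.of fun i => R *ᵥ M i) = Matrix.of M * Rᵀ := by
      ext i j
      simp [Matrix.mul_apply, Matrix.mulVec, dotProduct, mul_comm]
    have h1 : R *ᵥ x - (pinv (Matrix.of M * Rᵀ) * (Matrix.of M * Rᵀ)) *ᵥ (R *ᵥ x)
        = R *ᵥ (x - (pinv (Matrix.of M) * Matrix.of M) *ᵥ x) := by
      rw [pinv_mul_orthogonal _ hR', Matrix.transpose_transpose, Matrix.mulVec_mulVec,
        Matrix.mulVec_sub, Matrix.mulVec_mulVec]
      congr 2
      calc R * pinv (Matrix.of M) * (Matrix.of M * Rᵀ) * R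
          = R * (pinv (Matrix.of M) * Matrix.of M) * (Rᵀ * R) := by simp only [Matrix.mul_assoc]
        _ = _ := by rw [hR, Matrix.mul_one]
    have h2 : ∀ z : k → ℝ, ∑ l, (R *ᵥ z) l ^ 2 = ∑ l, z l ^ 2 := by
      intro z
      have : (R *ᵥ z) ⬝ᵥ (R *ᵥ z) = z ⬝ᵥ z := by
        rw [Matrix.dotProduct_mulVec, ← Matrix.mulVec_transpose, Matrix.mulVec_mulVec, hR,
          Matrix.one_mulVec]
      simpa [dotProduct, sq] using this
    rw [this, h1, h2]
  · intro c x
    rw [← lintegral_const_mul _ (hme x)]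
    refine lintegral_congr fun M => ?_
    rw [← ENNReal.ofReal_mul (sq_nonneg c), Finset.mul_sum]
    simp [Matrix.mulVec_smul, mul_pow, ← mul_sub]

end Averages

/-! ### Second moments -/

section SecondMoments

theorem lintegral_add_sq_gaussianReal (b : ℝ) (w : NNReal) :
    ∫⁻ y, ENNReal.ofReal ((y + b) ^ 2) ∂(gaussianReal 0 w) = ENNReal.ofReal (w + b ^ 2) := by
  have h2 : MemLp (fun y : ℝ => y + b) 2 (gaussianReal 0 w) :=
    (memLp_id_gaussianReal 2).add (memLp_const b)
  have hi : Integrable (fun y : ℝ => y) (gaussianReal 0 w) :=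
    (memLp_id_gaussianReal 1).integrable le_rfl
  rw [← ofReal_integral_eq_lintegral_ofReal h2.integrable_sq
    (Filter.Eventually.of_forall fun _ => sq_nonneg _)]
  congr 1
  have h3 := variance_eq_sub h2
  rw [variance_add_const hi.aestronglyMeasurable, variance_fun_id_gaussianReal,
    integral_add hi (integrable_const b), integral_id_gaussianReal] at h3
  simp only [integral_const, probReal_univ, smul_eq_mul, one_mul, zero_add, Pi.pow_apply] at h3
  linarith

theorem lintegral_dotProduct_add_sq {k : Type*} [Fintype k] (a : k → ℝ) (b : ℝ) :
    ∫⁻ r : k → ℝ, ENNReal.ofReal ((r ⬝ᵥ a + b) ^ 2) ∂(Measure.pi fun _ => gaussianReal 0 1) =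
      ENNReal.ofReal (a ⬝ᵥ a + b ^ 2) := by
  set L : StrongDual ℝ (EuclideanSpace ℝ k) := innerSL ℝ (WithLp.toLp 2 a) with hL
  have hna : ‖(WithLp.toLp 2 a : EuclideanSpace ℝ k)‖ ^ 2 = a ⬝ᵥ a := by
    rw [EuclideanSpace.real_norm_sq_eq]
    simp [dotProduct, sq]
  have hLG : (stdGaussian (EuclideanSpace ℝ k)).map L = gaussianReal 0 (a ⬝ᵥ a).toNNReal := by
    rw [IsGaussian.map_eq_gaussianReal, integral_strongDual_stdGaussian, variance_dual_stdGaussian,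
      hL, innerSL_apply_norm, hna]
  have h0 : 0 ≤ a ⬝ᵥ a := hna ▸ sq_nonneg _
  have h := lintegral_add_sq_gaussianReal b (a ⬝ᵥ a).toNNReal
  rw [← hLG, lintegral_map (by fun_prop) (by fun_prop), ← map_pi_eq_stdGaussian,
    lintegral_map (by fun_prop) (by fun_prop), Real.coe_toNNReal _ h0] at h
  rw [← h]
  refine lintegral_congr fun r => ?_
  simp [hL, innerSL_apply_apply, PiLp.inner_apply, dotProduct]

/-- Each coordinate of `M a` is centred Gaussian with variance `a ⬝ᵥ a`, so the cross term with `b`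
vanishes; only the marginal law of each row enters. -/
theorem lintegral_mulVec_add_sq {m k : Type*} [Fintype m] [Fintype k] (a : k → ℝ) (b : m → ℝ) :
    ∫⁻ M, ENNReal.ofReal ((Matrix.of M *ᵥ a + b) ⬝ᵥ (Matrix.of M *ᵥ a + b))
      ∂(gaussianMatrix m k) = ENNReal.ofReal (Fintype.card m * (a ⬝ᵥ a) + b ⬝ᵥ b) := by
  have h1 : ∀ M : m → k → ℝ, ENNReal.ofReal ((Matrix.of M *ᵥ a + b) ⬝ᵥ (Matrix.of M *ᵥ a + b))
      = ∑ i, ENNReal.ofReal ((M i ⬝ᵥ a + b i) ^ 2) := by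
    intro M
    rw [← ENNReal.ofReal_sum_of_nonneg fun i _ => sq_nonneg _]
    simp [dotProduct, Matrix.mulVec, sq]
  have hme : ∀ c : ℝ, Measurable fun r : k → ℝ => ENNReal.ofReal ((r ⬝ᵥ a + c) ^ 2) := by
    intro c
    simp only [dotProduct]
    fun_prop
  simp_rw [h1]
  have hme' : ∀ i, Measurable fun M : m → k → ℝ => ENNReal.ofReal ((M i ⬝ᵥ a + b i) ^ 2) :=
    fun i => (hme (b i)).comp (measurable_pi_apply i)
  rw [lintegral_finsetSum _ fun i _ => hme' i]
  have h2 : ∀ i, ∫⁻ M, ENNReal.ofReal ((M i ⬝ᵥ a + b i) ^ 2) ∂(gaussianMatrix m k)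
      = ENNReal.ofReal (a ⬝ᵥ a + b i ^ 2) := by
    intro i
    rw [← lintegral_dotProduct_add_sq a (b i)]
    exact (measurePreserving_eval (fun _ : m => Measure.pi fun _ : k => gaussianReal 0 1)
      i).lintegral_comp (hme (b i))
  rw [Finset.sum_congr rfl fun i _ => h2 i, ← ENNReal.ofReal_sum_of_nonneg]
  · congr 1
    rw [Finset.sum_add_distrib]
    simp [dotProduct, sq]
  · exact fun i _ => add_nonneg (Finset.sum_nonneg fun _ _ => mul_self_nonneg _) (sq_nonneg _)

theorem lintegral_sum_sq_eq_trace {Ω ι : Type*} [MeasurableSpace Ω] [Fintype ι] (P : Measure Ω)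
    [IsProbabilityMeasure P] (z : Ω → EuclideanSpace ℝ ι) (h2 : ∀ i, MemLp (fun ω => z ω i) 2 P)
    (h0 : ∀ i, ∫ ω, z ω i ∂P = 0) :
    ∫⁻ ω, ENNReal.ofReal (∑ i, z ω i ^ 2) ∂P = ENNReal.ofReal (covMatrix P z z).trace := by
  rw [← ofReal_integral_eq_lintegral_ofReal (integrable_finsetSum _ fun i _ => (h2 i).integrable_sq)
    (Filter.Eventually.of_forall fun _ => Finset.sum_nonneg fun i _ => sq_nonneg _)]
  congr 1
  rw [integral_finsetSum _ fun i _ => (h2 i).integrable_sq, Matrix.trace]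
  refine Finset.sum_congr rfl fun i _ => ?_
  simp only [Matrix.diag_apply, covMatrix, Matrix.of_apply]
  rw [covariance_self (h2 i).aestronglyMeasurable.aemeasurable,
    variance_of_integral_eq_zero (h2 i).aestronglyMeasurable.aemeasurable (h0 i)]

end SecondMoments

/-! ### Splitting the estimation error -/

section Error

variable {n p : ℕ}

/-- The columns of a matrix of functions whose index satisfies a predicate. -/
def colsOf (q : Fin p → Prop) (M : Fin n → Fin p → ℝ) : Fin n → {j // q j} → ℝ :=
  fun i j => M i j

/-- After transposition the columns are the outer index of a product measure, which factors along
`S` and its complement; hence `A_S` and `A_C` are independent. -/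
theorem measurePreserving_split_cols (S : Finset (Fin p)) :
    MeasurePreserving (fun M : Fin n → Fin p → ℝ => (colsOf (· ∈ S) M, colsOf (· ∉ S) M))
      (gaussianMatrix (Fin n) (Fin p))
      ((gaussianMatrix (Fin n) {j // j ∈ S}).prod (gaussianMatrix (Fin n) {j // j ∉ S})) := by
  have h1 := measurePreserving_transpose (Fin n) (Fin p)
  have h2 : MeasurePreserving (MeasurableEquiv.piEquivPiSubtypeProd
      (fun _ : Fin p => Fin n → ℝ) (· ∈ S)) (gaussianMatrix (Fin p) (Fin n))
      ((gaussianMatrix {j // j ∈ S} (Fin n)).prod (gaussianMatrix {j // j ∉ S} (Fin n))) := by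
    unfold gaussianMatrix
    convert measurePreserving_piEquivPiSubtypeProd
      (fun _ : Fin p => Measure.pi fun _ : Fin n => gaussianReal 0 1) (· ∈ S)
  have h3 := (measurePreserving_transpose {j // j ∈ S} (Fin n)).prod
    (measurePreserving_transpose {j // j ∉ S} (Fin n))
  exact h3.comp (h2.comp h1)

/-- The error of the estimate splits orthogonally. -/
theorem norm_sq_error_eq (S : Finset (Fin p)) (M : Fin n → Fin p → ℝ)
    (a : EuclideanSpace ℝ (Fin p)) (b : EuclideanSpace ℝ (Fin n)) :
    ‖subvec S a - WithLp.toLp 2 (partialLMMSE 1 0 (subcols S (Matrix.of M)) *ᵥ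
      (obs (Matrix.of M) a b).ofLp)‖ ^ 2 =
    ∑ l, ((fun j : {j // j ∈ S} => a j) - (pinv (Matrix.of (colsOf (· ∈ S) M)) *
        Matrix.of (colsOf (· ∈ S) M)) *ᵥ (fun j => a j)) l ^ 2 +
      ∑ l, (pinv (Matrix.of (colsOf (· ∈ S) M)) *ᵥ
        (Matrix.of (colsOf (· ∉ S) M) *ᵥ (fun j => a j) + b.ofLp)) l ^ 2 := by
  set B := Matrix.of (colsOf (· ∈ S) M) with hB
  set D := Matrix.of (colsOf (· ∉ S) M) with hD
  set aS : {j // j ∈ S} → ℝ := fun j => a j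
  set aC : {j // j ∉ S} → ℝ := fun j => a j
  have hW : partialLMMSE 1 0 (subcols S (Matrix.of M)) = pinv B := by
    have : subcols S (Matrix.of M) = B := rfl
    rw [this, partialLMMSE, Matrix.one_mul, Matrix.mul_one, add_zero,
      transpose_mul_pinv_mul_transpose]
  have hobs : (obs (Matrix.of M) a b).ofLp = B *ᵥ aS + (D *ᵥ aC + b.ofLp) := by
    rw [← add_assoc]
    have : Matrix.of M *ᵥ a.ofLp = B *ᵥ aS + D *ᵥ aC := by
      ext i
      change ∑ j, M i j * a j = ∑ j : {j // j ∈ S}, M i j * a j + ∑ j : {j // j ∉ S}, M i j * a j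
      rw [← Fintype.sum_subtype_add_sum_subtype (· ∈ S)]
      congr!
    rw [← this]
    rfl
  set u := D *ᵥ aC + b.ofLp
  rw [hW, hobs, Matrix.mulVec_add, Matrix.mulVec_mulVec, EuclideanSpace.real_norm_sq_eq]
  set Pr := pinv B * B with hPr
  have hsymm : Prᵀ = Pr := (pinv_spec B).symm_right
  have hPX : Pr * pinv B = pinv B := (pinv_spec B).mul_mul_right
  -- `Pr` is a symmetric projection fixing the range of `B⁺`, so it can be moved across the product.
  have horth : (aS - Pr *ᵥ aS) ⬝ᵥ (pinv B *ᵥ u) = 0 := by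
    rw [sub_dotProduct, ← hsymm, Matrix.mulVec_transpose, ← Matrix.dotProduct_mulVec,
      Matrix.mulVec_mulVec, hPX, sub_self]
  have h : ∀ l, (subvec S a - WithLp.toLp 2 (Pr *ᵥ aS + pinv B *ᵥ u) : EuclideanSpace ℝ S) l
      = (aS - Pr *ᵥ aS) l - (pinv B *ᵥ u) l := by
    intro l
    simp only [PiLp.sub_apply, Pi.sub_apply, Pi.add_apply, sub_sub]
    rfl
  simp_rw [h, sub_sq]
  rw [Finset.sum_add_distrib, Finset.sum_sub_distrib]
  have : ∑ l, 2 * (aS - Pr *ᵥ aS) l * (pinv B *ᵥ u) l = 0 := by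
    simp_rw [mul_assoc]
    rw [← Finset.mul_sum]
    exact mul_eq_zero_of_right _ horth
  rw [this, sub_zero]

/-- The mean squared error over a Gaussian regressor matrix, for fixed unknowns and noise. -/
theorem lintegral_norm_sq_error (S : Finset (Fin p)) (hS : 0 < S.card) (hn : 0 < n)
    (a : EuclideanSpace ℝ (Fin p)) (b : EuclideanSpace ℝ (Fin n)) :
    ∫⁻ M, ENNReal.ofReal (‖subvec S a - WithLp.toLp 2
        (partialLMMSE 1 0 (subcols S (Matrix.of M)) *ᵥ (obs (Matrix.of M) a b).ofLp)‖ ^ 2)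
      ∂(gaussianMatrix (Fin n) (Fin p)) =
    ENNReal.ofReal ((S.card : ℝ) - (min S.card n : ℕ)) / S.card *
        ENNReal.ofReal (∑ j : {j // j ∈ S}, a j ^ 2) +
      gam S.card n / n *
        ENNReal.ofReal (n * ∑ j : {j // j ∉ S}, a j ^ 2 + ∑ i, b i ^ 2) := by
  have hpinv := fun l i => measurable_pinv_apply (m := Fin n) (k := {j // j ∈ S}) l i
  have hS0 : (S.card : ℝ≥0∞) ≠ 0 := by exact_mod_cast hS.ne'
  have hn0 : (n : ℝ≥0∞) ≠ 0 := by exact_mod_cast hn.ne'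
  set f : (Fin n → {j // j ∈ S} → ℝ) → ℝ≥0∞ := fun B => ENNReal.ofReal
    (∑ l, ((fun j : {j // j ∈ S} => a j) - (pinv (Matrix.of B) * Matrix.of B) *ᵥ
      (fun j => a j)) l ^ 2) with hf
  set g : (Fin n → {j // j ∈ S} → ℝ) × (Fin n → {j // j ∉ S} → ℝ) → ℝ≥0∞ := fun q =>
    ENNReal.ofReal (∑ l, (pinv (Matrix.of q.1) *ᵥ
        (Matrix.of q.2 *ᵥ (fun j => a j) + b.ofLp)) l ^ 2) with hg
  have hfm : Measurable f := by
    simp only [hf, Matrix.mulVec, dotProduct, Pi.sub_apply, Matrix.mul_apply, Matrix.of_apply]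
    fun_prop
  have hgm : Measurable g := by
    have hpinv' : ∀ l i, Measurable fun q : (Fin n → {j // j ∈ S} → ℝ) × (Fin n → {j // j ∉ S} → ℝ)
        => pinv (Matrix.of q.1) l i := fun l i => (hpinv l i).comp measurable_fst
    simp only [hg, Matrix.mulVec, dotProduct, Pi.add_apply, Matrix.of_apply]
    fun_prop
  have hsplit := measurePreserving_split_cols (n := n) S
  have h1 : (S.card : ℝ≥0∞) * ∫⁻ B, f B ∂(gaussianMatrix (Fin n) {j // j ∈ S}) =
      ENNReal.ofReal (∑ j : {j // j ∈ S}, a j ^ 2) *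
        ENNReal.ofReal ((S.card : ℝ) - (min S.card n : ℕ)) := by
    have := card_mul_lintegral_sub_pinv_mul_mulVec (m := Fin n) (fun j : {j // j ∈ S} => a j)
    rw [Fintype.card_coe, Fintype.card_fin, min_comm n] at this
    simpa [dotProduct, sq, hf] using this
  have h2 : ∀ D : Fin n → {j // j ∉ S} → ℝ, (n : ℝ≥0∞) * ∫⁻ B, g (B, D)
      ∂(gaussianMatrix (Fin n) {j // j ∈ S}) = ENNReal.ofReal
        ((Matrix.of D *ᵥ (fun j => a j) + b.ofLp) ⬝ᵥ (Matrix.of D *ᵥ (fun j => a j) + b.ofLp)) *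
          gam S.card n := by
    intro D
    have := card_mul_lintegral_pinv_mulVec (k := {j // j ∈ S})
      (Matrix.of D *ᵥ (fun j => a j) + b.ofLp)
    rw [pinvEnergy_eq_gam _ _ (by simpa using hn) (by simpa using hS), Fintype.card_coe,
      Fintype.card_fin] at this
    exact this
  have h3 : (n : ℝ≥0∞) * ∫⁻ q, g q ∂((gaussianMatrix (Fin n) {j // j ∈ S}).prod
      (gaussianMatrix (Fin n) {j // j ∉ S})) =
      ENNReal.ofReal (n * ∑ j : {j // j ∉ S}, a j ^ 2 + ∑ i, b i ^ 2) * gam S.card n := by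
    -- The inner integral is over `B` with `D` frozen: `D x_C + v` is then a fixed vector and
    -- isotropy applies.
    rw [lintegral_prod_symm _ hgm.aemeasurable,
      ← lintegral_const_mul _ hgm.lintegral_prod_left']
    simp_rw [h2]
    rw [lintegral_mul_const, lintegral_mulVec_add_sq, Fintype.card_fin]
    · simp [dotProduct, sq]
    · simp only [Matrix.mulVec, dotProduct, Pi.add_apply, Matrix.of_apply]
      fun_prop
  calc _ = ∫⁻ M, (f (colsOf (· ∈ S) M) + g (colsOf (· ∈ S) M, colsOf (· ∉ S) M))
        ∂(gaussianMatrix (Fin n) (Fin p)) := by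
        refine lintegral_congr fun M => ?_
        rw [norm_sq_error_eq, ENNReal.ofReal_add (Finset.sum_nonneg fun _ _ => sq_nonneg _)
          (Finset.sum_nonneg fun _ _ => sq_nonneg _)]
    _ = ∫⁻ q, (f q.1 + g q) ∂((gaussianMatrix (Fin n) {j // j ∈ S}).prod
          (gaussianMatrix (Fin n) {j // j ∉ S})) :=
        hsplit.lintegral_comp (f := fun q => f q.1 + g q) (by fun_prop)
    _ = ∫⁻ B, f B ∂(gaussianMatrix (Fin n) {j // j ∈ S}) +
          ∫⁻ q, g q ∂((gaussianMatrix (Fin n) {j // j ∈ S}).prod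
            (gaussianMatrix (Fin n) {j // j ∉ S})) := by
        rw [lintegral_add_left (by fun_prop), measurePreserving_fst.lintegral_comp hfm]
    _ = _ := by
        rw [ENNReal.eq_div_iff hS0 (ENNReal.natCast_ne_top _) |>.mpr h1,
          ENNReal.eq_div_iff hn0 (ENNReal.natCast_ne_top _) |>.mpr h3]
        simp only [div_eq_mul_inv]
        ring

end Error

/-! ### Transfer to the given random variables and exchange of expectations -/

theorem map_regressors_eq_gaussianMatrix {n p : ℕ} {Ω' : Type*} [MeasurableSpace Ω']
    (P' : Measure Ω') [IsProbabilityMeasure P'] (A : Ω' → Matrix (Fin n) (Fin p) ℝ)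
    (hAlaw : ∀ i, HasLaw (fun ω' => (WithLp.toLp 2 (A ω' i) : EuclideanSpace ℝ (Fin p)))
      (multivariateGaussian 0 1) P')
    (hAindep : iIndepFun
      (fun i ω' => (WithLp.toLp 2 (A ω' i) : EuclideanSpace ℝ (Fin p))) P') :
    AEMeasurable (fun ω' i j => A ω' i j) P' ∧
      P'.map (fun ω' i j => A ω' i j) = gaussianMatrix (Fin n) (Fin p) := by
  have hm : ∀ i, AEMeasurable
      (fun ω' => (WithLp.toLp 2 (A ω' i) : EuclideanSpace ℝ (Fin p))) P' :=
    fun i => (hAlaw i).aemeasurable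
  have hmap := (iIndepFun_iff_map_fun_eq_pi_map hm).mp hAindep
  simp_rw [(hAlaw _).map_eq, multivariateGaussian_zero_one] at hmap
  have hpres : MeasurePreserving
      (fun (X : Fin n → EuclideanSpace ℝ (Fin p)) i => (X i).ofLp)
      (Measure.pi fun _ => stdGaussian (EuclideanSpace ℝ (Fin p)))
      (gaussianMatrix (Fin n) (Fin p)) :=
    measurePreserving_pi _ _ fun _ => measurePreserving_ofLp_stdGaussian
  have hX : AEMeasurable
      (fun ω' i => (WithLp.toLp 2 (A ω' i) : EuclideanSpace ℝ (Fin p))) P' :=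
    aemeasurable_pi_lambda _ hm
  refine ⟨hpres.measurable.comp_aemeasurable hX, ?_⟩
  rw [← hpres.map_eq, ← hmap, AEMeasurable.map_map_of_aemeasurable hpres.measurable.aemeasurable hX]
  rfl

/-- Tonelli needs this joint measurability; the orthogonal splitting reduces it to the entries of
`A_S⁺`. -/
theorem measurable_sq_error {n p : ℕ} (S : Finset (Fin p)) :
    Measurable fun q : (Fin n → Fin p → ℝ) ×
        (EuclideanSpace ℝ (Fin p) × EuclideanSpace ℝ (Fin n)) =>
      ENNReal.ofReal (‖subvec S q.2.1 - WithLp.toLp 2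
        (partialLMMSE 1 0 (subcols S (Matrix.of q.1)) *ᵥ
          (obs (Matrix.of q.1) q.2.1 q.2.2).ofLp)‖ ^ 2) := by
  simp_rw [norm_sq_error_eq]
  have hcols : Measurable fun M : Fin n → Fin p → ℝ => colsOf (· ∈ S) M := by
    unfold colsOf; fun_prop
  have hpinv : ∀ l i, Measurable fun q : (Fin n → Fin p → ℝ) ×
      (EuclideanSpace ℝ (Fin p) × EuclideanSpace ℝ (Fin n)) =>
        pinv (Matrix.of (colsOf (· ∈ S) q.1)) l i :=
    fun l i => (measurable_pinv_apply l i).comp (hcols.comp measurable_fst)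
  simp only [Matrix.mulVec, dotProduct, Pi.sub_apply, Pi.add_apply, Matrix.mul_apply,
    Matrix.of_apply]
  have hM : ∀ i j, Measurable fun q : (Fin n → Fin p → ℝ) ×
      (EuclideanSpace ℝ (Fin p) × EuclideanSpace ℝ (Fin n)) => q.1 i j := by fun_prop
  have hS : ∀ i (j : {j // j ∈ S}), Measurable fun q : (Fin n → Fin p → ℝ) ×
      (EuclideanSpace ℝ (Fin p) × EuclideanSpace ℝ (Fin n)) => colsOf (· ∈ S) q.1 i j :=
    fun i j => hM i j
  have hC : ∀ i (j : {j // j ∉ S}), Measurable fun q : (Fin n → Fin p → ℝ) ×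
      (EuclideanSpace ℝ (Fin p) × EuclideanSpace ℝ (Fin n)) => colsOf (· ∉ S) q.1 i j :=
    fun i j => hM i j
  fun_prop

/-- The expected MSE under Gaussian regressors, averaging over the regressors first. -/
theorem expectedMSE_eq_lintegral {n p : ℕ} {Ω Ω' : Type*} [MeasurableSpace Ω] [MeasurableSpace Ω']
    (P : Measure Ω) [IsProbabilityMeasure P] (P' : Measure Ω')
    {x : Ω → EuclideanSpace ℝ (Fin p)} {v : Ω → EuclideanSpace ℝ (Fin n)}
    (hx : AEMeasurable x P) (hv : AEMeasurable v P) {A : Ω' → Matrix (Fin n) (Fin p) ℝ}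
    (hA : AEMeasurable (fun ω' i j => A ω' i j) P')
    (hmap : P'.map (fun ω' i j => A ω' i j) = gaussianMatrix (Fin n) (Fin p))
    (S : Finset (Fin p)) (hS : 0 < S.card) (hn : 0 < n) :
    expectedMSE P x v P' A S 1 0 =
      ∫⁻ ω, (ENNReal.ofReal ((S.card : ℝ) - (min S.card n : ℕ)) / S.card *
          ENNReal.ofReal (∑ j : {j // j ∈ S}, x ω j ^ 2) +
        gam S.card n / n *
          ENNReal.ofReal (n * ∑ j : {j // j ∉ S}, x ω j ^ 2 + ∑ i, v ω i ^ 2)) ∂P := by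
  set h : (Fin n → Fin p → ℝ) → EuclideanSpace ℝ (Fin p) × EuclideanSpace ℝ (Fin n) → ℝ≥0∞ :=
    fun M z => ENNReal.ofReal (‖subvec S z.1 - WithLp.toLp 2
        (partialLMMSE 1 0 (subcols S (Matrix.of M)) *ᵥ (obs (Matrix.of M) z.1 z.2).ofLp)‖ ^ 2)
    with hh
  have hm : Measurable (Function.uncurry h) := measurable_sq_error S
  have hz : AEMeasurable (fun ω => (x ω, v ω)) P := hx.prodMk hv
  -- The variables are only almost everywhere measurable, so the exchange takes place between their
  -- laws.
  set κ := P.map fun ω => (x ω, v ω) with hκ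
  have : IsProbabilityMeasure κ := Measure.isProbabilityMeasure_map hz
  have hm1 : Measurable fun M => ∫⁻ z, h M z ∂κ := hm.lintegral_prod_right'
  have hm2 : Measurable fun z => ∫⁻ M, h M z ∂(gaussianMatrix (Fin n) (Fin p)) :=
    hm.lintegral_prod_left'
  calc expectedMSE P x v P' A S 1 0
      = ∫⁻ ω', ∫⁻ z, h (fun i j => A ω' i j) z ∂κ ∂P' := by
        refine lintegral_congr fun ω' => ?_
        rw [hκ, lintegral_map' (hm.of_uncurry_left).aemeasurable hz]
        rfl
    _ = ∫⁻ M, ∫⁻ z, h M z ∂κ ∂(gaussianMatrix (Fin n) (Fin p)) := by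
        rw [← hmap]
        exact (lintegral_map' hm1.aemeasurable hA).symm
    _ = ∫⁻ z, ∫⁻ M, h M z ∂(gaussianMatrix (Fin n) (Fin p)) ∂κ :=
        lintegral_lintegral_swap hm.aemeasurable
    _ = ∫⁻ ω, ∫⁻ M, h M (x ω, v ω) ∂(gaussianMatrix (Fin n) (Fin p)) ∂P := by
        rw [hκ]
        exact lintegral_map' hm2.aemeasurable hz
    _ = _ := lintegral_congr fun ω => lintegral_norm_sq_error S hS hn (x ω) (v ω)

theorem memLp_coord {Ω ι : Type*} [MeasurableSpace Ω] [Fintype ι] {P : Measure Ω}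
    {z : Ω → EuclideanSpace ℝ ι} (hz : MemLp z 2 P) (i : ι) : MemLp (fun ω => z ω i) 2 P :=
  (EuclideanSpace.proj (𝕜 := ℝ) i).comp_memLp' hz

theorem integral_coord_eq_zero {Ω ι : Type*} [MeasurableSpace Ω] [Fintype ι] {P : Measure Ω}
    [IsProbabilityMeasure P] {z : Ω → EuclideanSpace ℝ ι} (hz : MemLp z 2 P)
    (h0 : ∫ ω, z ω ∂P = 0) (i : ι) : ∫ ω, z ω i ∂P = 0 := by
  have := (EuclideanSpace.proj (𝕜 := ℝ) i).integral_comp_comm (hz.integrable one_le_two)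
  rw [h0, map_zero] at this
  exact this

end PartialLMMSE

/-! ### The expected MSE -/

theorem corollary1 {n p : ℕ} {Ω Ω' : Type*} [MeasurableSpace Ω] [MeasurableSpace Ω']
    (P : Measure Ω) [IsProbabilityMeasure P] (P' : Measure Ω') [IsProbabilityMeasure P']
    -- the unknowns and the noise: zero-mean, uncorrelated, with finite second moments
    (x : Ω → EuclideanSpace ℝ (Fin p)) (v : Ω → EuclideanSpace ℝ (Fin n))
    (hx : MemLp x 2 P) (hv : MemLp v 2 P)
    (hx0 : ∫ ω, x ω ∂P = 0) (hv0 : ∫ ω, v ω ∂P = 0)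
    (hxv : PartialLMMSE.covMatrix P x v = 0)
    -- the regressors: the rows of the random matrix are i.i.d. standard Gaussian vectors
    (A : Ω' → Matrix (Fin n) (Fin p) ℝ)
    (hAlaw : ∀ i, HasLaw (fun ω' => (WithLp.toLp 2 (A ω' i) : EuclideanSpace ℝ (Fin p)))
      (multivariateGaussian 0 1) P')
    (hAindep : iIndepFun
      (fun i ω' => (WithLp.toLp 2 (A ω' i) : EuclideanSpace ℝ (Fin p))) P')
    -- the estimated unknowns are those indexed by `S`
    (S : Finset (Fin p)) (σx σv : ℝ)
    (hKS : (PartialLMMSE.covMatrix P (fun ω => PartialLMMSE.subvec S (x ω))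
      (fun ω => PartialLMMSE.subvec S (x ω))).trace = σx ^ 2 * (S.card : ℝ))
    (hKSpos : 0 < σx ^ 2 * (S.card : ℝ))
    (hKC : (PartialLMMSE.covMatrix P (fun ω => PartialLMMSE.subvec Sᶜ (x ω))
      (fun ω => PartialLMMSE.subvec Sᶜ (x ω))).trace = σx ^ 2 * (Sᶜ.card : ℝ))
    (hKv : (PartialLMMSE.covMatrix P v v).trace = (n : ℝ) * σv ^ 2)
    (hKvpos : 0 < (n : ℝ) * σv ^ 2) :
    PartialLMMSE.expectedMSE P x v P' A S 1 0 =
      ENNReal.ofReal (σx ^ 2 * ((S.card : ℝ) - (min S.card n : ℕ))) +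
        PartialLMMSE.gam S.card n *
          ENNReal.ofReal (σx ^ 2 * (Sᶜ.card : ℝ) + σv ^ 2) := by

  have hS : 0 < S.card := by
    by_contra h
    have : S.card = 0 := by omega
    simp [this] at hKSpos
  have hn : 0 < n := by
    by_contra h
    have : n = 0 := by omega
    subst this
    simp at hKvpos
  have hS0 : (S.card : ℝ≥0∞) ≠ 0 := by exact_mod_cast hS.ne'
  have hn0 : (n : ℝ≥0∞) ≠ 0 := by exact_mod_cast hn.ne'
  obtain ⟨hA, hmap⟩ := PartialLMMSE.map_regressors_eq_gaussianMatrix P' A hAlaw hAindep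
  have hx2 := PartialLMMSE.memLp_coord hx
  have hv2 := PartialLMMSE.memLp_coord hv
  have hx0' := PartialLMMSE.integral_coord_eq_zero hx hx0
  have hv0' := PartialLMMSE.integral_coord_eq_zero hv hv0
  have hSint := PartialLMMSE.lintegral_sum_sq_eq_trace P (fun ω => PartialLMMSE.subvec S (x ω))
    (fun i => hx2 i) (fun i => hx0' i)
  have hCint := PartialLMMSE.lintegral_sum_sq_eq_trace P (fun ω => PartialLMMSE.subvec Sᶜ (x ω))
    (fun i => hx2 i) (fun i => hx0' i)
  have hvint := PartialLMMSE.lintegral_sum_sq_eq_trace P v hv2 hv0'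
  rw [hKS] at hSint
  rw [hKC] at hCint
  rw [hKv] at hvint
  -- The column splitting indexes the complement by a subtype, the covariance by the finset `Sᶜ`.
  have hCsum : ∀ ω, ∑ j : {j // j ∉ S}, x ω j ^ 2
      = ∑ j, (PartialLMMSE.subvec Sᶜ (x ω)) j ^ 2 := by
    intro ω
    rw [← Finset.sum_subtype Sᶜ (fun j => by simp) fun j => x ω j ^ 2,
      ← Finset.sum_coe_sort Sᶜ fun j => x ω j ^ 2]
    rfl
  have hmS : AEMeasurable (fun ω => ∑ j : {j // j ∈ S}, x ω j ^ 2) P :=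
    Finset.aemeasurable_fun_sum _ fun j _ =>
      (hx2 j).aestronglyMeasurable.aemeasurable.pow_const 2
  have hmC : AEMeasurable (fun ω => ∑ j : {j // j ∉ S}, x ω j ^ 2) P :=
    Finset.aemeasurable_fun_sum _ fun j _ =>
      (hx2 j).aestronglyMeasurable.aemeasurable.pow_const 2
  have hmv : AEMeasurable (fun ω => ∑ i, v ω i ^ 2) P :=
    Finset.aemeasurable_fun_sum _ fun j _ =>
      (hv2 j).aestronglyMeasurable.aemeasurable.pow_const 2
  have hmCv : AEMeasurable
      (fun ω => n * ∑ j : {j // j ∉ S}, x ω j ^ 2 + ∑ i, v ω i ^ 2) P := (hmC.const_mul _).add hmv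
  -- The noise trace also carries a factor `n`, so `n` comes out of the whole sum and cancels the `1
  -- / n` from isotropy.
  have hnoise : ∫⁻ ω, ENNReal.ofReal (n * ∑ j : {j // j ∉ S}, x ω j ^ 2 + ∑ i, v ω i ^ 2) ∂P
      = n * ENNReal.ofReal (σx ^ 2 * (Sᶜ.card : ℝ) + σv ^ 2) := by
    have h1 : ∀ ω, ENNReal.ofReal (n * ∑ j : {j // j ∉ S}, x ω j ^ 2 + ∑ i, v ω i ^ 2)
        = n * ENNReal.ofReal (∑ j : {j // j ∉ S}, x ω j ^ 2)
          + ENNReal.ofReal (∑ i, v ω i ^ 2) := by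
      intro ω
      have hnn : 0 ≤ ∑ j : {j // j ∉ S}, x ω j ^ 2 := Finset.sum_nonneg fun _ _ => sq_nonneg _
      rw [ENNReal.ofReal_add (mul_nonneg (Nat.cast_nonneg _) hnn)
        (Finset.sum_nonneg fun _ _ => sq_nonneg _), ENNReal.ofReal_mul (Nat.cast_nonneg _),
        ENNReal.ofReal_natCast]
    simp_rw [h1]
    rw [lintegral_add_right' _ hmv.ennreal_ofReal, lintegral_const_mul'' _ hmC.ennreal_ofReal]
    simp_rw [hCsum]
    rw [hCint, hvint, ENNReal.ofReal_mul (Nat.cast_nonneg n), ENNReal.ofReal_natCast, ← mul_add,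
      ← ENNReal.ofReal_add (by positivity) (sq_nonneg _)]
  have hsig : ∫⁻ ω, ENNReal.ofReal (∑ j : {j // j ∈ S}, x ω j ^ 2) ∂P
      = ENNReal.ofReal (σx ^ 2) * S.card := by
    rw [← ENNReal.ofReal_natCast, ← ENNReal.ofReal_mul (sq_nonneg _), ← hSint]
    rfl
  rw [PartialLMMSE.expectedMSE_eq_lintegral P P' hx.1.aemeasurable hv.1.aemeasurable hA hmap S hS hn,
    lintegral_add_left' (hmS.ennreal_ofReal.const_mul _), lintegral_const_mul'' _ hmS.ennreal_ofReal,
    lintegral_const_mul'' _ hmCv.ennreal_ofReal, hnoise, hsig]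
  congr 1
  · rw [mul_comm (ENNReal.ofReal (σx ^ 2)), ← mul_assoc,
      ENNReal.div_mul_cancel hS0 (ENNReal.natCast_ne_top _), mul_comm,
      ← ENNReal.ofReal_mul (sq_nonneg _)]
  · rw [← mul_assoc, ENNReal.div_mul_cancel hn0 (ENNReal.natCast_ne_top _)]
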